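/- **Theorem 4.2.** Let $1\le k\le n$ be integers, let $p>1$, $-1<\alpha<\frac1k-1$ and $\beta<p-1$ be real constants, and let $f:\mathbb R\to(0,+\infty)$ be continuous and non-decreasing. Consider $$S_k^{1/k}\big[D(|Du|^{p-2}Du)\big]=|x|^\alpha|Du|^\beta f(u)\quad\text{in }\mathbb R^n, \tag{1.5}$$ where $S_k[A]=\sum_{i_1<\dots<i_k}\lambda_{i_1}\cdots\lambda_{i_k}$ for a matrix $A$ with eigenvalues $\lambda=(\lambda_1,\dots,\lambda_n)$ (for $Du=0$ we put $|Du|^{p-2}Du=0$). An *entire nontrivial admissible subsolution* of (1.5) is a non-constant function $u\in C^1(\mathbb R^n)\cap C^2(\mathbb R^n\setminus\{0\})$ such that at every $x\ne0$ the field $|Du|^{p-2}Du$ is differentiable, the eigenvalues of $D(|Du|^{p-2}Du)(x)$ lie in $\Gamma_k=\{\lambda\in\mathbb R^n: S_i(\lambda)>0,\ i=1,\dots,k\}$, and $S_k^{1/k}[D(|Du|^{p-2}Du)]\ge|x|^\alpha|Du|^\beta f(u)$ (where $0^\beta=+\infty$ if $\beta<0$ and $0^0=1$). (a) Suppose that for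 some $\epsilon\in(0,k(\alpha+1))$, with $\kappa=\frac{1-\epsilon}{k(\alpha+1)-\epsilon}$, $$\int^{+\infty}\Big(\int_0^t f^{\kappa k}(s)\,ds\Big)^{-\frac1{\kappa k(p-\beta-1)+1}}dt=+\infty .$$ Then there is an entire nontrivial admissible subsolution $u$ of (1.5). Moreover, this $u$ has the following properties: (i) if $p\le\alpha+\beta+2$, then $u\in C^2(\mathbb R^n)$; (ii) if $p>\alpha+\beta+2$ and $(p-1)\alpha+\beta\ge0$, then $u\in W^{2,\delta}_{loc}(\mathbb R^n)$ for every $\delta\in\big(1,\frac{p-\beta-1}{p-\alpha-\beta-2}\big)$. (b) Conversely, suppose that (1.5) has an entire nontrivial admissible subsolution $u$ such that either $p\le\alpha+\beta+2$ and $u\in C^2(\mathbb R^n)$, or $p>\alpha+\beta+2$, $(p-1)\alpha+\beta\ge0$ and $u\in W^{2,\delta}_{loc}(\mathbb R^n)$ for some $\delta\in\big(1,\frac{p-\beta-1}{p-\alpha-\beta-2}\big)$. Then $$\int^{+\infty}\Big(\int_0^t f^{k}(s)\,ds\Big)^{-\frac1{k(p-\beta-1)+1}}dt=+\infty .$$ (In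 both conditions the lower limit of the outer integral is any positive number.) -/

import Mathlib

open MeasureTheory

open scoped ContDiff

noncomputable section

/-- The divergence of the improper integral `∫^{+∞} (∫_0^t g(s) ds)^{-1/(θ+1)} dt`,
for every positive lower limit. -/
def KellerOsserman (g : ℝ → ℝ) (θ : ℝ) : Prop :=
  ∀ c : ℝ, 0 < c →
    ∫⁻ t in Set.Ioi c, ENNReal.ofReal ((∫ s in (0 : ℝ)..t, g s) ^ (-(1 / (θ + 1)))) = ⊤

/-- The elementary symmetric polynomial `S_k(λ) = ∑_{i₁ < ⋯ < i_k} λ_{i₁} ⋯ λ_{i_k}`. -/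
def elemSymm {n : ℕ} (k : ℕ) (lam : Fin n → ℝ) : ℝ :=
  ∑ s ∈ Finset.powersetCard k (Finset.univ : Finset (Fin n)), ∏ i ∈ s, lam i

/-- Gårding's cone `Γ_k = {λ ∈ ℝⁿ | S_i(λ) > 0, i = 1, …, k}`. -/
def gardingCone (n k : ℕ) : Set (Fin n → ℝ) :=
  {lam | ∀ i ∈ Finset.Icc 1 k, 0 < elemSymm i lam}

/-- `lam` lists all the eigenvalues of `A`, which are then real, with algebraic multiplicity. -/
def IsEigenvalueVector {n : ℕ} (A : Matrix (Fin n) (Fin n) ℝ) (lam : Fin n → ℝ) : Prop :=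
  A.charpoly = ∏ i, (Polynomial.X - Polynomial.C (lam i))

/-- The vector field `|Du|^{p-2} Du`, which is zero where `Du = 0`. -/
def pGradient {n : ℕ} (p : ℝ) (u : EuclideanSpace ℝ (Fin n) → ℝ) (x : EuclideanSpace ℝ (Fin n)) :
    EuclideanSpace ℝ (Fin n) :=
  ‖gradient u x‖ ^ (p - 2) • gradient u x

/-- The Jacobian matrix `D(|Du|^{p-2} Du)`. -/
def pHessian {n : ℕ} (p : ℝ) (u : EuclideanSpace ℝ (Fin n) → ℝ) (x : EuclideanSpace ℝ (Fin n)) :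
    Matrix (Fin n) (Fin n) ℝ :=
  Matrix.of fun i j => fderiv ℝ (pGradient p u) x (EuclideanSpace.single j 1) i

/-- At the point `x ≠ 0`, the function `u` is admissible (`|Du|^{p-2} Du` is differentiable and the
eigenvalues of its derivative lie in `Γ_k`) and satisfies
`S_k^{1/k}[D(|Du|^{p-2} Du)] ≥ |x|^α |Du|^β f(u)`.
The inequality is between extended nonnegative reals, so that the right-hand side is `∞` where
`Du = 0` and `β < 0`; for `β = 0` the factor `|Du|^β` is `1`. -/
def IsAdmissibleSubsolutionAt {n : ℕ} (k : ℕ) (p α β : ℝ) (f : ℝ → ℝ)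
    (u : EuclideanSpace ℝ (Fin n) → ℝ) (x : EuclideanSpace ℝ (Fin n)) : Prop :=
  DifferentiableAt ℝ (pGradient p u) x ∧
    ∃ lam : Fin n → ℝ, IsEigenvalueVector (pHessian p u x) lam ∧ lam ∈ gardingCone n k ∧
      ENNReal.ofReal ‖x‖ ^ α * ENNReal.ofReal ‖gradient u x‖ ^ β * ENNReal.ofReal (f (u x)) ≤
        ENNReal.ofReal (elemSymm k lam ^ (1 / (k : ℝ)))

/-- An entire nontrivial admissible subsolution `u ∈ C¹(ℝⁿ) ∩ C²(ℝⁿ \ {0})` of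
`S_k^{1/k}[D(|Du|^{p-2} Du)] = |x|^α |Du|^β f(u)`. For `α < 0` the right-hand side is singular at
the origin, and the inequality and the admissibility are required at all other points. -/
structure IsEntireSubsolution {n : ℕ} (k : ℕ) (p α β : ℝ) (f : ℝ → ℝ)
    (u : EuclideanSpace ℝ (Fin n) → ℝ) : Prop where
  contDiff_one : ContDiff ℝ 1 u
  contDiffOn_two : ContDiffOn ℝ 2 u {0}ᶜ
  nontrivial : ¬ ∃ c : ℝ, ∀ x, u x = c
  subsolution : ∀ x, x ≠ 0 → IsAdmissibleSubsolutionAt k p α β f u x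

/-- `g ∈ L^δ_loc(ℝⁿ)`. -/
def MemLpLoc {n : ℕ} (δ : ℝ) (g : EuclideanSpace ℝ (Fin n) → ℝ) : Prop :=
  ∀ K : Set (EuclideanSpace ℝ (Fin n)), IsCompact K →
    MemLp g (ENNReal.ofReal δ) (volume.restrict K)

/-- `g` is the weak partial derivative `∂_i u` on `ℝⁿ`. -/
def HasWeakPartialDeriv {n : ℕ} (i : Fin n) (u g : EuclideanSpace ℝ (Fin n) → ℝ) : Prop :=
  LocallyIntegrable u ∧ LocallyIntegrable g ∧
    ∀ φ : EuclideanSpace ℝ (Fin n) → ℝ, ContDiff ℝ ∞ φ → HasCompactSupport φ →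
      ∫ x, u x * fderiv ℝ φ x (EuclideanSpace.single i 1) = -∫ x, g x * φ x

/-- `u ∈ W^{2,δ}_loc(ℝⁿ)`. -/
def MemW2Loc {n : ℕ} (δ : ℝ) (u : EuclideanSpace ℝ (Fin n) → ℝ) : Prop :=
  MemLpLoc δ u ∧
    ∃ (g : Fin n → EuclideanSpace ℝ (Fin n) → ℝ) (h : Fin n → Fin n → EuclideanSpace ℝ (Fin n) → ℝ),
      (∀ i, HasWeakPartialDeriv i u (g i) ∧ MemLpLoc δ (g i)) ∧
        ∀ i j, HasWeakPartialDeriv j (g i) (h i j) ∧ MemLpLoc δ (h i j)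

end

/-! Everything is tested on radial functions `v = Φ(r^{1+m}/(1+m))`, `r = |x - y|`, with `Φ' =
G(Φ)`. Then `|Dv| = G(v) r^m`, and `D(|Dv|^{p-2} Dv)` has one radial eigenvalue and `n - 1` equal
tangential ones. With `q = k(p-β-1)`, `S_k` is comparable to `|Dv|^{βk} G^q r^{mq-k} (G' r^{m+1} +
1)`. So the factor `|Dv|^β` cancels from the equation, and making `G^{q+1}` essentially a primitive
of `f^k` reduces it to an autonomous first-order ODE.

Sufficiency. Take `m = (α+1)/(p-β-1)`, so that `r^{mq-k} = r^{αk}`. The profile is global as soon as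
`∫ 1/G` diverges. The hypothesis has exponent `κ ≥ 1`; if `(t f^k)^{-1/(q+1)}` were integrable,
`f^k` would grow at least like `t^q`, and the integral with `κ` would converge too
(`not_integrableOn_of_kellerOsserman`). The regularity of `u` at the origin is that of `|x|^{1+m}`:
`C²` if `m ≥ 1`, otherwise with second derivatives of size `|x|^{m-1}`.

Necessity. If the integral converges, there are profiles that climb from a fixed value `v₀ < u(0)`
to any height within a fixed time (`exists_barrier_of_not_kellerOsserman`). Centred at `y` in a
distant annulus, with `m = 1/(p-β-1)`, they are strict supersolutions that dominate `u` on a sphere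
around `y`; comparison gives `u(y) ≤ v₀` where `Du(y) ≠ 0`, and by density on a whole sphere around
the origin. The maximum principle then gives `u(0) ≤ v₀`, which is absurd.

Comparison (`elemSymm_le_of_isLocalMax`) rests on the monotonicity of `S_k` on Gårding's cone, which
comes from Newton's inequality for real-rooted polynomials. -/

/-! ### Newton's inequality and Gårding's cone. -/

section ElementarySymmetric

open Polynomial

/-- The derivative of a real-rooted polynomial is real-rooted. -/
theorem splits_derivative_of_splits {P : ℝ[X]} (hP : P.Splits) : P.derivative.Splits := by
  rw [splits_iff_card_roots] at hP ⊢
  refine le_antisymm (card_roots' _) ?_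
  have h1 := card_roots_le_derivative P
  rw [natDegree_derivative]
  omega

/-- The Laguerre inequality at the origin for a real-rooted polynomial. -/
theorem two_mul_coeff_zero_mul_coeff_two_le {P : ℝ[X]} (hP : P.Splits) :
    2 * (P.coeff 0 * P.coeff 2) ≤ P.coeff 1 ^ 2 := by
  have key : ∀ s : Multiset ℝ, 2 * ((s.map (fun a => X - C a)).prod.coeff 0 *
      (s.map (fun a => X - C a)).prod.coeff 2) ≤ (s.map (fun a => X - C a)).prod.coeff 1 ^ 2 := by
    intro s
    induction s using Multiset.induction_on with
    | empty => simp [coeff_one]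
    | cons r s ih =>
      simp only [Multiset.map_cons, Multiset.prod_cons, sub_mul, coeff_sub, coeff_C_mul]
      rw [coeff_X_mul_zero, coeff_X_mul (n := 1), coeff_X_mul (n := 0)]
      set Q := (s.map (fun a => X - C a)).prod
      -- For `(X - r) Q` the defect `c₁² - 2 c₀ c₂` equals `Q₀² + r² (Q₁² - 2 Q₀ Q₂)`.
      nlinarith [sq_nonneg (Q.coeff 0), mul_nonneg (sq_nonneg r) (sub_nonneg.2 ih)]
  rw [hP.eq_prod_roots]
  simp only [coeff_C_mul]
  nlinarith [mul_nonneg (sq_nonneg P.leadingCoeff) (sub_nonneg.2 (key P.roots))]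

/-- A weak form of Newton's inequality for the coefficients of a real-rooted polynomial. -/
theorem coeff_mul_coeff_add_two_le {P : ℝ[X]} (hP : P.Splits) (j : ℕ)
    (h : 0 ≤ P.coeff j * P.coeff (j + 2)) :
    P.coeff j * P.coeff (j + 2) ≤ P.coeff (j + 1) ^ 2 := by
  -- The `j`-th derivative moves the coefficients `j`, `j+1`, `j+2` to `0`, `1`, `2`. The factorials
  -- then give `(j+2) c_j c_{j+2} ≤ (j+1) c_{j+1}²`, and the sign hypothesis allows `j+2` to be
  -- lowered to `j+1`.
  have hs : (derivative^[j] P).Splits := by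
    clear h
    induction j with
    | zero => exact hP
    | succ j ih =>
      rw [Function.iterate_succ_apply']
      exact splits_derivative_of_splits ih
  have := two_mul_coeff_zero_mul_coeff_two_le hs
  simp only [coeff_iterate_derivative, nsmul_eq_mul] at this
  have e0 : ((0 + j).descFactorial j : ℝ) = j.factorial := by simp [Nat.descFactorial_self]
  have e1 : ((1 + j).descFactorial j : ℝ) = (j + 1) * j.factorial := by
    have := Nat.factorial_mul_descFactorial (Nat.le_add_left j 1)
    rw [show 1 + j - j = 1 by omega, Nat.factorial_one, one_mul] at this
    rw [this, add_comm, Nat.factorial_succ]; push_cast; ring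
  have e2 : 2 * ((2 + j).descFactorial j : ℝ) = (j + 2) * ((j + 1) * j.factorial) := by
    have := Nat.factorial_mul_descFactorial (Nat.le_add_left j 2)
    rw [show 2 + j - j = 2 by omega, Nat.factorial_two] at this
    have h2 : (2 : ℝ) * ((2 + j).descFactorial j : ℝ) = ((2 + j).factorial : ℝ) := by
      exact_mod_cast this
    rw [h2, add_comm, Nat.factorial_succ, Nat.factorial_succ]; push_cast; ring
  rw [e0, e1, zero_add, add_comm 1 j, add_comm 2 j] at this
  rw [add_comm 2 j] at e2
  set F : ℝ := (j.factorial : ℝ)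
  have hF : 0 < F := by positivity
  have h3 : F ^ 2 * (j + 1) * ((j + 2) * (P.coeff j * P.coeff (j + 2)))
      ≤ F ^ 2 * (j + 1) * ((j + 1) * P.coeff (j + 1) ^ 2) := by
    calc _ = F * P.coeff j * ((2 * ((j + 2).descFactorial j : ℝ)) * P.coeff (j + 2)) := by
          rw [e2]; ring
      _ ≤ _ := by linarith
  have hj : (0 : ℝ) ≤ j := Nat.cast_nonneg j
  have h4 := le_of_mul_le_mul_left h3 (by positivity)
  have h5 : (j + 1 : ℝ) * (P.coeff j * P.coeff (j + 2)) ≤ (j + 1) * P.coeff (j + 1) ^ 2 := by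
    nlinarith
  exact le_of_mul_le_mul_left h5 (by positivity)

variable {n : ℕ}

/-- The generating polynomial of the elementary symmetric functions of `lam i`, `i ∈ I`. -/
noncomputable def symmPoly (I : Finset (Fin n)) (lam : Fin n → ℝ) : ℝ[X] :=
  ∏ i ∈ I, (1 + C (lam i) * X)

theorem elemSymm_eq_coeff (j : ℕ) (lam : Fin n → ℝ) :
    elemSymm j lam = (symmPoly Finset.univ lam).coeff j := by
  unfold elemSymm symmPoly
  rw [Finset.prod_one_add, finsetSum_coeff]
  have : ∀ t : Finset (Fin n), (∏ i ∈ t, (C (lam i) * X)).coeff j =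
      if t.card = j then ∏ i ∈ t, lam i else 0 := by
    intro t
    rw [Finset.prod_mul_distrib, Finset.prod_const, ← map_prod, coeff_C_mul_X_pow]
    simp [eq_comm]
  simp only [this]
  rw [← Finset.sum_filter]
  congr 1
  ext t
  simp

theorem splits_symmPoly (I : Finset (Fin n)) (lam : Fin n → ℝ) : (symmPoly I lam).Splits := by
  unfold symmPoly
  refine Splits.prod fun i _ => ?_
  refine Splits.of_natDegree_le_one ?_
  compute_degree

theorem coeff_zero_symmPoly (I : Finset (Fin n)) (lam : Fin n → ℝ) :
    (symmPoly I lam).coeff 0 = 1 := by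
  simp [symmPoly, coeff_zero_prod]

theorem coeff_succ_symmPoly (i : Fin n) (lam : Fin n → ℝ) (j : ℕ) :
    (symmPoly Finset.univ lam).coeff (j + 1) =
      (symmPoly (Finset.univ.erase i) lam).coeff (j + 1) +
        lam i * (symmPoly (Finset.univ.erase i) lam).coeff j := by
  have : symmPoly Finset.univ lam =
      symmPoly (Finset.univ.erase i) lam +
        C (lam i) * (X * symmPoly (Finset.univ.erase i) lam) := by
    unfold symmPoly
    rw [← Finset.mul_prod_erase Finset.univ _ (Finset.mem_univ i)]
    ring
  rw [this, coeff_add, coeff_C_mul, coeff_X_mul]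

/-- Deleting an entry of a vector of `Γ_k` leaves a vector of `Γ_{k-1}`. -/
theorem coeff_symmPoly_erase_pos {k : ℕ} {lam : Fin n → ℝ} (h : lam ∈ gardingCone n k)
    (i : Fin n) : ∀ j < k, 0 < (symmPoly (Finset.univ.erase i) lam).coeff j := by
  set a := (symmPoly (Finset.univ.erase i) lam).coeff with ha
  have hs : ∀ j < k, 0 < a (j + 1) + lam i * a j := by
    intro j hj
    have := h (j + 1) (Finset.mem_Icc.2 ⟨by omega, by omega⟩)
    rwa [elemSymm_eq_coeff, coeff_succ_symmPoly i] at this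
  have h0 : a 0 = 1 := coeff_zero_symmPoly _ _
  intro j
  induction j with
  | zero => intro _; rw [h0]; exact one_pos
  | succ j ih =>
    intro hj
    have hj1 := ih (by omega)
    have h1 := hs j (by omega)
    have h2 := hs (j + 1) hj
    -- If `a_{j+1} ≤ 0 < a_j`, then `S_{j+1} > 0` forces `λ_i > 0`, and `S_{j+2} > 0` forces
    -- `a_{j+2} > -λ_i a_{j+1}`. Hence `a_j a_{j+2} > a_{j+1}²`, against Newton.
    by_contra hneg
    push Not at hneg
    have hl : 0 < lam i := by
      by_contra hl
      nlinarith
    have h3 : 0 < a (j + 2) := by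
      nlinarith
    have h4 := coeff_mul_coeff_add_two_le (splits_symmPoly (Finset.univ.erase i) lam) j
      (mul_nonneg hj1.le h3.le)
    rw [← ha] at h4
    have h5 : a (j + 1) ^ 2 ≤ a j * (lam i * -a (j + 1)) := by nlinarith
    have h6 : a j * (lam i * -a (j + 1)) < a j * a (j + 2) :=
      mul_lt_mul_of_pos_left (by linarith) hj1
    linarith

end ElementarySymmetric

/-! ### Monotonicity of the elementary symmetric functions of the eigenvalues. -/

section Matrices

open Polynomial Matrix

variable {n : ℕ}

/-- The determinant of a rank-one perturbation of an invertible diagonal matrix. -/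
theorem det_diagonal_add_vecMulVec {K : Type*} [Field K] {d : Fin n → K} (hd : ∀ i, d i ≠ 0)
    (v w : Fin n → K) :
    (diagonal d + vecMulVec v w).det =
      ∏ i, d i + ∑ i, v i * w i * ∏ l ∈ Finset.univ.erase i, d l := by
  have hu : IsUnit (diagonal d).det := by
    rw [det_diagonal, isUnit_iff_ne_zero]
    exact Finset.prod_ne_zero_iff.2 fun i _ => hd i
  rw [vecMulVec_eq Unit, det_add_replicateCol_mul_replicateRow hu, det_diagonal]
  have hinv : (diagonal d)⁻¹ = diagonal (fun i => (d i)⁻¹) := by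
    refine inv_eq_right_inv ?_
    rw [diagonal_mul_diagonal, ← diagonal_one]
    congr 1
    ext i
    exact mul_inv_cancel₀ (hd i)
  rw [hinv, det_unique, Matrix.add_apply, one_apply_eq, mul_add, mul_one]
  congr 1
  rw [Matrix.mul_apply, Finset.mul_sum]
  refine Finset.sum_congr rfl fun i _ => ?_
  rw [mul_diagonal, ← Finset.mul_prod_erase Finset.univ d (Finset.mem_univ i)]
  simp only [replicateRow_apply, replicateCol_apply]
  field_simp [hd i]

/-- The reversed characteristic polynomial `det (1 + X A)`. -/
noncomputable def detOneAdd (A : Matrix (Fin n) (Fin n) ℝ) : ℝ[X] :=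
  det (1 + (X : ℝ[X]) • A.map C)

theorem detOneAdd_eq_charpolyRev_comp (A : Matrix (Fin n) (Fin n) ℝ) :
    detOneAdd A = A.charpolyRev.comp (-X) := by
  unfold detOneAdd charpolyRev
  rw [← coe_compRingHom_apply, RingHom.map_det]
  congr 1
  ext1 i j
  by_cases h : i = j <;>
  simp [h, one_apply, Matrix.sub_apply, Matrix.smul_apply]

theorem detOneAdd_congr {A B : Matrix (Fin n) (Fin n) ℝ} (h : A.charpoly = B.charpoly) :
    detOneAdd A = detOneAdd B := by
  rw [detOneAdd_eq_charpolyRev_comp, detOneAdd_eq_charpolyRev_comp, ← reverse_charpoly,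
    ← reverse_charpoly, h]

theorem isEigenvalueVector_diagonal (lam : Fin n → ℝ) :
    IsEigenvalueVector (diagonal lam) lam := charpoly_diagonal lam

/-- The matrix determinant lemma, applied over rational functions, where the entries `1 + λ_i X` are
invertible. For `v = w` the increment has the coefficients `v_i²` in front of symmetric functions
with one entry deleted. -/
theorem detOneAdd_diagonal_add (lam v w : Fin n → ℝ) :
    detOneAdd (diagonal lam + vecMulVec v w) =
      symmPoly Finset.univ lam +
        ∑ i, C (v i * w i) * (X * symmPoly (Finset.univ.erase i) lam) := by
  have hinj : Function.Injective (algebraMap ℝ[X] (RatFunc ℝ)) :=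
    RatFunc.algebraMap_injective ℝ
  apply hinj
  have hne : ∀ i, algebraMap ℝ[X] (RatFunc ℝ) (1 + C (lam i) * X) ≠ 0 := by
    intro i h0
    rw [map_eq_zero_iff _ hinj] at h0
    have := congrArg (fun q => coeff q 0) h0
    simp at this
  have key := det_diagonal_add_vecMulVec hne
    (fun i => algebraMap ℝ[X] (RatFunc ℝ) (X * C (v i)))
    (fun i => algebraMap ℝ[X] (RatFunc ℝ) (C (w i)))
  unfold detOneAdd
  rw [RingHom.map_det]
  convert key using 1
  · congr 1
    ext1 i j
    by_cases h : i = j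
    · subst h
      simp [vecMulVec_apply]
      ring
    · simp [h, vecMulVec_apply]
      ring
  · unfold symmPoly
    simp only [map_add, map_sum, map_mul, map_prod]
    congr 1
    refine Finset.sum_congr rfl fun i _ => ?_
    ring

theorem IsEigenvalueVector.detOneAdd_eq {A : Matrix (Fin n) (Fin n) ℝ} {lam : Fin n → ℝ}
    (h : IsEigenvalueVector A lam) : detOneAdd A = symmPoly Finset.univ lam := by
  have := detOneAdd_diagonal_add lam 0 0
  simp only [Pi.zero_apply, mul_zero, map_zero, zero_mul, Finset.sum_const_zero, add_zero] at this
  rw [← this]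
  refine detOneAdd_congr ?_
  rw [show vecMulVec (0 : Fin n → ℝ) (0 : Fin n → ℝ) = 0 by ext; simp [vecMulVec_apply], add_zero]
  exact h.trans (isEigenvalueVector_diagonal lam).symm

theorem IsEigenvalueVector.elemSymm_eq {A : Matrix (Fin n) (Fin n) ℝ} {lam : Fin n → ℝ}
    (h : IsEigenvalueVector A lam) (j : ℕ) : elemSymm j lam = (detOneAdd A).coeff j := by
  rw [h.detOneAdd_eq, elemSymm_eq_coeff]

theorem IsEigenvalueVector.congr {A B : Matrix (Fin n) (Fin n) ℝ} {lam : Fin n → ℝ}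
    (h : IsEigenvalueVector A lam) (hAB : A.charpoly = B.charpoly) : IsEigenvalueVector B lam :=
  hAB.symm.trans h

/-- `a I + v wᵀ` has the eigenvalue `a + v ⬝ w`, and `a` with multiplicity `n - 1`. -/
theorem isEigenvalueVector_smul_one_add_vecMulVec (a : ℝ) (v w : Fin n → ℝ) (i₀ : Fin n) :
    IsEigenvalueVector (a • (1 : Matrix (Fin n) (Fin n) ℝ) + vecMulVec v w)
      (fun i => if i = i₀ then a + v ⬝ᵥ w else a) := by
  have hc : IsEigenvalueVector (vecMulVec v w) (fun i => if i = i₀ then v ⬝ᵥ w else 0) := by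
    unfold IsEigenvalueVector
    rw [charpoly_vecMulVec, ← Finset.mul_prod_erase Finset.univ _ (Finset.mem_univ i₀),
      Finset.prod_congr rfl (g := fun _ => (X : ℝ[X]))
        (by intro i hi; simp [Finset.ne_of_mem_erase hi]), Finset.prod_const,
      Finset.card_erase_of_mem (Finset.mem_univ _)]
    simp only [Finset.card_univ, Fintype.card_fin, if_true]
    have hn : n = (n - 1) + 1 := by have := i₀.2; omega
    rw [sub_mul, ← pow_succ', ← hn, smul_eq_C_mul]
  have hcomp : (a • (1 : Matrix (Fin n) (Fin n) ℝ) + vecMulVec v w).charpoly =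
      (vecMulVec v w).charpoly.comp (X - C a) := by
    unfold charpoly
    rw [← coe_compRingHom_apply, RingHom.map_det]
    congr 1
    ext1 i j
    by_cases h : i = j
    · subst h; simp [charmatrix_apply_eq]; ring
    · simp [h]
  unfold IsEigenvalueVector at *
  rw [hcomp, hc, prod_comp]
  refine Finset.prod_congr rfl fun i _ => ?_
  by_cases h : i = i₀ <;> simp [h]
  ring

/-- A rank-one nonnegative perturbation does not decrease the elementary symmetric functions of the
eigenvalues on Gårding's cone. -/
theorem coeff_detOneAdd_le_add_vecMulVec {A : Matrix (Fin n) (Fin n) ℝ} (hA : A.IsHermitian)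
    {k : ℕ} (hk : ∀ j ∈ Finset.Icc 1 k, 0 < (detOneAdd A).coeff j) (v : Fin n → ℝ) :
    ∀ j ≤ k, (detOneAdd A).coeff j ≤ (detOneAdd (A + vecMulVec v v)).coeff j := by
  set U : Matrix (Fin n) (Fin n) ℝ := (hA.eigenvectorUnitary : Matrix (Fin n) (Fin n) ℝ) with hU
  have hU1 : star U * U = 1 := Unitary.coe_star_mul_self hA.eigenvectorUnitary
  have hU2 : U * star U = 1 := Unitary.coe_mul_star_self hA.eigenvectorUnitary
  have hspec : A = U * diagonal hA.eigenvalues * star U := by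
    have := hA.spectral_theorem
    rw [Unitary.conjStarAlgAut_apply] at this
    simpa using this
  have heig : IsEigenvalueVector A hA.eigenvalues := by
    unfold IsEigenvalueVector
    simpa using hA.charpoly_eq
  set lam := hA.eigenvalues
  -- In an orthonormal eigenbasis of `A` the perturbation is still of the form `w wᵀ`.
  set w : Fin n → ℝ := star U *ᵥ v with hw
  have hsum : (A + vecMulVec v v).charpoly = (diagonal lam + vecMulVec w w).charpoly := by
    have h1 : A + vecMulVec v v = U * ((diagonal lam + vecMulVec w w) * star U) := by
      have hv : v = U *ᵥ w := by rw [hw, mulVec_mulVec, hU2, one_mulVec]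
      have : vecMulVec v v = U * vecMulVec w w * star U := by
        rw [mul_vecMulVec, vecMulVec_mul, ← hv]
        congr 1
        conv_lhs => rw [hv]
        rw [star_eq_conjTranspose, conjTranspose_eq_transpose_of_trivial, vecMul_transpose]
      rw [add_mul, mul_add, ← mul_assoc, ← mul_assoc, ← this, ← hspec]
    rw [h1, charpoly_mul_comm, mul_assoc, hU1, mul_one]
  have hcone : lam ∈ gardingCone n k := by
    intro j hj
    rw [heig.elemSymm_eq]
    exact hk j hj
  intro j hj
  rw [detOneAdd_congr hsum, detOneAdd_diagonal_add, heig.detOneAdd_eq]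
  cases j with
  | zero => simp
  | succ j =>
    rw [coeff_add, finsetSum_coeff]
    refine le_add_of_nonneg_right (Finset.sum_nonneg fun i _ => ?_)
    rw [coeff_C_mul, coeff_X_mul]
    exact mul_nonneg (mul_self_nonneg _) (coeff_symmPoly_erase_pos hcone i j (by omega)).le

/-- Monotonicity of the elementary symmetric functions of the eigenvalues on Gårding's cone. -/
theorem coeff_detOneAdd_le_of_posSemidef_sub {A B : Matrix (Fin n) (Fin n) ℝ} (hA : A.IsHermitian)
    (hAB : (B - A).PosSemidef) {k : ℕ} (hk : ∀ j ∈ Finset.Icc 1 k, 0 < (detOneAdd A).coeff j) :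
    ∀ j ≤ k, (detOneAdd A).coeff j ≤ (detOneAdd B).coeff j := by
  obtain ⟨D, hD⟩ : ∃ D : Matrix (Fin n) (Fin n) ℝ, B - A = Dᴴ * D := by
    open scoped MatrixOrder in
    exact CStarAlgebra.nonneg_iff_eq_star_mul_self.1 hAB.nonneg
  have hB : B = A + ∑ i, vecMulVec (D i) (D i) := by
    rw [eq_add_of_sub_eq' hD]
    congr 1
    ext i j
    simp [Matrix.mul_apply, Matrix.sum_apply, vecMulVec_apply]
  -- Rank-one terms are added one at a time. The coefficients only grow, so each partial sum still
  -- satisfies the cone condition needed for the next term.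
  have key : ∀ s : Finset (Fin n), (A + ∑ i ∈ s, vecMulVec (D i) (D i)).IsHermitian ∧
      ∀ j ≤ k, (detOneAdd A).coeff j ≤ (detOneAdd (A + ∑ i ∈ s, vecMulVec (D i) (D i))).coeff j := by
    intro s
    induction s using Finset.induction_on with
    | empty => simpa using hA
    | insert i s hi ih =>
      rw [Finset.sum_insert hi, add_comm (vecMulVec _ _), ← add_assoc]
      refine ⟨ih.1.add ?_, fun j hj => (ih.2 j hj).trans ?_⟩
      · ext a b; simp [vecMulVec_apply, mul_comm]
      · refine coeff_detOneAdd_le_add_vecMulVec ih.1 (k := k) ?_ _ j hj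
        intro l hl
        exact (hk l hl).trans_le (ih.2 l (Finset.mem_Icc.1 hl).2)
  rw [hB]
  exact (key Finset.univ).2

end Matrices

/-! ### Calculus at an interior maximum. -/

section Comparison

open scoped RealInnerProductSpace Gradient

variable {E : Type*} [NormedAddCommGroup E] [InnerProductSpace ℝ E]

theorem hasFDerivAt_norm_of_ne_zero {x : E} (hx : x ≠ 0) :
    HasFDerivAt (fun z : E => ‖z‖) (‖x‖⁻¹ • innerSL ℝ x) x := by
  have h := ((hasStrictFDerivAt_norm_sq x).hasFDerivAt).sqrt (by simpa using hx)
  have hn : ‖x‖ ≠ 0 := norm_ne_zero_iff.2 hx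
  convert h using 1
  · ext z; rw [Real.sqrt_sq (norm_nonneg z)]
  · rw [Real.sqrt_sq (norm_nonneg x), ofNat_smul_eq_nsmul, ← Nat.cast_smul_eq_nsmul ℝ, smul_smul]
    congr 1
    push_cast
    field_simp

/-- The derivative of a radial vector field. -/
theorem hasFDerivAt_radial_smul {x : E} (hx : x ≠ 0) {χ : ℝ → ℝ} {c : ℝ}
    (hχ : HasDerivAt χ c ‖x‖) :
    HasFDerivAt (fun z : E => χ ‖z‖ • z)
      (χ ‖x‖ • ContinuousLinearMap.id ℝ E +
        (c / ‖x‖) • (innerSL ℝ x).smulRight x) x := by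
  have h1 : HasFDerivAt (fun z : E => χ ‖z‖) (c • (‖x‖⁻¹ • innerSL ℝ x)) x :=
    hχ.comp_hasFDerivAt x (hasFDerivAt_norm_of_ne_zero hx)
  have h2 : HasFDerivAt (fun z : E => χ ‖z‖ • z) _ x := h1.smul (hasFDerivAt_id x)
  convert h2 using 1
  rw [smul_smul, div_eq_mul_inv]
  ext h
  simp [smul_smul]

/-- A positive second derivative would make the point a local minimum as well, so the function would
be locally constant. -/
theorem deriv_deriv_nonpos_of_isLocalMax {f : ℝ → ℝ} {a : ℝ} (h : IsLocalMax f a)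
    (hc : ContinuousAt f a) : deriv (deriv f) a ≤ 0 := by
  by_contra hpos
  push Not at hpos
  have hmin := isLocalMin_of_deriv_deriv_pos hpos h.deriv_eq_zero hc
  have heq : f =ᶠ[nhds a] fun _ => f a := by
    filter_upwards [h, hmin] with z h1 h2
    exact le_antisymm h1 h2
  have : deriv (deriv f) a = 0 := by
    rw [(heq.deriv).deriv_eq]
    simp
  linarith

theorem fderiv_fderiv_nonpos_of_isLocalMax {w : E → ℝ} {x : E} (hw : ContDiffAt ℝ 2 w x)
    (hmax : IsLocalMax w x) (h : E) : fderiv ℝ (fderiv ℝ w) x h h ≤ 0 := by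
  set l : ℝ → E := fun t => x + t • h with hl
  have hl0 : l 0 = x := by simp [hl]
  have hld : ∀ t, HasDerivAt l h t := by
    intro t
    have := ((hasDerivAt_id t).smul_const h).const_add x
    rwa [one_smul] at this
  have hlc : ContinuousAt l 0 := (hld 0).continuousAt
  have hlt : Filter.Tendsto l (nhds 0) (nhds x) := by
    have := hlc.tendsto
    rwa [hl0] at this
  have hmax' : IsLocalMax (w ∘ l) 0 := by
    have := hlt.eventually hmax
    filter_upwards [this] with t ht
    simpa [hl0] using ht
  have hev : ∀ᶠ z in nhds x, DifferentiableAt ℝ w z := by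
    have := hw.eventually (by simp)
    filter_upwards [this] with z hz
    exact hz.differentiableAt two_ne_zero
  have hder : deriv (w ∘ l) =ᶠ[nhds 0] fun t => fderiv ℝ w (l t) h := by
    filter_upwards [hlt.eventually hev] with t ht
    exact (ht.hasFDerivAt.comp_hasDerivAt t (hld t)).deriv
  have h1 : ContDiffAt ℝ 1 (fderiv ℝ w) x := hw.fderiv_right (by norm_num)
  have h2 : HasFDerivAt (fderiv ℝ w) (fderiv ℝ (fderiv ℝ w) x) (l 0) := by
    rw [hl0]
    exact (h1.differentiableAt one_ne_zero).hasFDerivAt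
  have h3 : HasDerivAt (fun t => fderiv ℝ w (l t) h) (fderiv ℝ (fderiv ℝ w) x h h) 0 := by
    have := (h2.comp_hasDerivAt 0 (hld 0)).clm_apply (hasDerivAt_const (0 : ℝ) h)
    simpa using this
  have h4 := deriv_deriv_nonpos_of_isLocalMax hmax'
    (ContinuousAt.comp (by rw [hl0]; exact hw.continuousAt) hlc)
  rwa [hder.deriv_eq, h3.deriv] at h4

variable [CompleteSpace E]

theorem ContDiffAt.differentiableAt_gradient {u : E → ℝ} {x : E} (hu : ContDiffAt ℝ 2 u x) :
    DifferentiableAt ℝ (∇ u) x := by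
  have h1 : ContDiffAt ℝ 1 (fderiv ℝ u) x := hu.fderiv_right (by norm_num)
  have h2 : DifferentiableAt ℝ (fderiv ℝ u) x := h1.differentiableAt one_ne_zero
  exact (InnerProductSpace.toDual ℝ E).symm.toContinuousLinearEquiv.differentiableAt.comp x h2

theorem inner_fderiv_gradient {u : E → ℝ} {x : E} (hu : ContDiffAt ℝ 2 u x) (h h' : E) :
    ⟪fderiv ℝ (∇ u) x h, h'⟫ = fderiv ℝ (fderiv ℝ u) x h h' := by
  have h1 : ContDiffAt ℝ 1 (fderiv ℝ u) x := hu.fderiv_right (by norm_num)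
  have h2 : DifferentiableAt ℝ (fderiv ℝ u) x := h1.differentiableAt one_ne_zero
  have : HasFDerivAt (∇ u) _ x :=
    ((InnerProductSpace.toDual ℝ E).symm.toContinuousLinearEquiv.hasFDerivAt).comp x h2.hasFDerivAt
  rw [this.fderiv]
  simp

theorem inner_fderiv_gradient_comm {u : E → ℝ} {x : E} (hu : ContDiffAt ℝ 2 u x) (h h' : E) :
    ⟪fderiv ℝ (∇ u) x h, h'⟫ = ⟪fderiv ℝ (∇ u) x h', h⟫ := by
  rw [inner_fderiv_gradient hu, inner_fderiv_gradient hu]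
  exact (hu.isSymmSndFDerivAt (by simp)).eq h h'

theorem gradient_eq_of_isLocalMax_sub {u v : E → ℝ} {x : E} (hu : DifferentiableAt ℝ u x)
    (hv : DifferentiableAt ℝ v x) (hmax : IsLocalMax (fun z => u z - v z) x) : ∇ u x = ∇ v x := by
  have := hmax.fderiv_eq_zero
  rw [fderiv_fun_sub hu hv, sub_eq_zero] at this
  simp [gradient, this]

end Comparison

/-! ### Comparison for `D(|Du|^{p-2} Du)`. -/

section ComparisonMatrix

open Matrix
open scoped RealInnerProductSpace Gradient

variable {n : ℕ}

/-- The matrix of an endomorphism of `ℝⁿ` in the standard basis. -/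
noncomputable def euclMatrix
    (T : EuclideanSpace ℝ (Fin n) →L[ℝ] EuclideanSpace ℝ (Fin n)) : Matrix (Fin n) (Fin n) ℝ :=
  Matrix.of fun i j => T (EuclideanSpace.single j 1) i

theorem euclMatrix_comp (S T : EuclideanSpace ℝ (Fin n) →L[ℝ] EuclideanSpace ℝ (Fin n)) :
    euclMatrix (S.comp T) = euclMatrix S * euclMatrix T := by
  ext i j
  have h : T (EuclideanSpace.single j 1) =
      ∑ l, (T (EuclideanSpace.single j 1) l) • EuclideanSpace.single l (1 : ℝ) := by
    ext l
    simp [Finset.sum_apply, Pi.single_apply]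
  simp only [euclMatrix, of_apply, Matrix.mul_apply, ContinuousLinearMap.comp_apply]
  conv_lhs => rw [h]
  simp [mul_comm]

theorem euclMatrix_radial (a b : ℝ) (x : EuclideanSpace ℝ (Fin n)) :
    euclMatrix (a • ContinuousLinearMap.id ℝ _ + b • (innerSL ℝ x).smulRight x) =
      a • (1 : Matrix (Fin n) (Fin n) ℝ) + vecMulVec (b • x.ofLp) x.ofLp := by
  ext i j
  simp [euclMatrix, vecMulVec_apply, one_apply, EuclideanSpace.inner_single_right]
  exact Or.inl (mul_comm _ _)

theorem inner_eq_dotProduct_euclMatrix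
    (T : EuclideanSpace ℝ (Fin n) →L[ℝ] EuclideanSpace ℝ (Fin n)) (y : Fin n → ℝ) :
    y ⬝ᵥ (euclMatrix T *ᵥ y) = ⟪T (WithLp.toLp 2 y), WithLp.toLp 2 y⟫ := by
  have h : (WithLp.toLp 2 y : EuclideanSpace ℝ (Fin n)) =
      ∑ l, y l • EuclideanSpace.single l (1 : ℝ) := by
    ext l
    simp [Finset.sum_apply, Pi.single_apply]
  rw [EuclideanSpace.inner_eq_star_dotProduct]
  congr 1
  ext i
  rw [h]
  simp [euclMatrix, mulVec, dotProduct, mul_comm]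

theorem hasFDerivAt_rpow_norm_smul {p : ℝ} {g : EuclideanSpace ℝ (Fin n)} (hg : g ≠ 0) :
    HasFDerivAt (fun z : EuclideanSpace ℝ (Fin n) => ‖z‖ ^ (p - 2) • z)
      (‖g‖ ^ (p - 2) • ContinuousLinearMap.id ℝ _ +
        (((p - 2) * ‖g‖ ^ (p - 2 - 1)) / ‖g‖) • (innerSL ℝ g).smulRight g) g :=
  hasFDerivAt_radial_smul hg (χ := fun r => r ^ (p - 2))
    (Real.hasDerivAt_rpow_const (Or.inl (norm_ne_zero_iff.2 hg)))

theorem hasFDerivAt_pGradient {p : ℝ} {u : EuclideanSpace ℝ (Fin n) → ℝ}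
    {x : EuclideanSpace ℝ (Fin n)} (hu : ContDiffAt ℝ 2 u x) (hg : ∇ u x ≠ 0) :
    HasFDerivAt (pGradient p u) ((‖∇ u x‖ ^ (p - 2) • ContinuousLinearMap.id ℝ _ +
        (((p - 2) * ‖∇ u x‖ ^ (p - 2 - 1)) / ‖∇ u x‖) •
          (innerSL ℝ (∇ u x)).smulRight (∇ u x)).comp (fderiv ℝ (∇ u) x)) x :=
  (hasFDerivAt_rpow_norm_smul hg).comp x hu.differentiableAt_gradient.hasFDerivAt

/-- The derivative of `|z|^{p-2} z` has the eigenvalue `(p-1)|g|^{p-2}` along `g` and `|g|^{p-2}`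
across it. Both are positive as `p > 1`, and `b` is chosen to give the root the eigenvalue `a
√(p-1)` along `g`. -/
theorem exists_isHermitian_sq_eq {p : ℝ} (hp : 1 < p) {g : EuclideanSpace ℝ (Fin n)} (hg : g ≠ 0) :
    ∃ Q : Matrix (Fin n) (Fin n) ℝ, Q.IsHermitian ∧
      euclMatrix (‖g‖ ^ (p - 2) • ContinuousLinearMap.id ℝ _ +
        (((p - 2) * ‖g‖ ^ (p - 2 - 1)) / ‖g‖) • (innerSL ℝ g).smulRight g) = Q * Q := by
  have hn : 0 < ‖g‖ := norm_pos_iff.2 hg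
  set a := ‖g‖ ^ ((p - 2) / 2) with ha
  set b := a * (√(p - 1) - 1) / ‖g‖ ^ 2 with hb
  have haa : ‖g‖ ^ (p - 2) = a * a := by
    rw [ha, ← Real.rpow_add hn]; congr 1; ring
  have hs : √(p - 1) ^ 2 = p - 1 := Real.sq_sqrt (by linarith)
  refine ⟨a • 1 + b • vecMulVec g.ofLp g.ofLp, ?_, ?_⟩
  · ext i j
    simp [vecMulVec_apply, one_apply, eq_comm, mul_comm]
  · have hvv : vecMulVec g.ofLp g.ofLp * vecMulVec g.ofLp g.ofLp =
        ‖g‖ ^ 2 • vecMulVec g.ofLp g.ofLp := by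
      rw [vecMulVec_mul_vecMulVec, EuclideanSpace.norm_sq_eq]
      ext i j
      simp [vecMulVec_apply, dotProduct, sq]
      ring
    rw [euclMatrix_radial, Real.rpow_sub_one hn.ne', haa]
    rw [add_mul, mul_add, mul_add]
    simp only [smul_mul_assoc, mul_smul_comm, one_mul, mul_one, hvv]
    rw [smul_vecMulVec]
    have hcoef : (p - 2) * (a * a / ‖g‖) / ‖g‖ = 2 * (a * b) + b * b * ‖g‖ ^ 2 := by
      rw [hb]
      field_simp
      linear_combination -a ^ 2 * hs
    rw [hcoef]
    module

/-- **Comparison at an interior maximum of `u - v`.** -/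
theorem elemSymm_le_of_isLocalMax {k : ℕ} {p : ℝ} (hp : 1 < p)
    {u v : EuclideanSpace ℝ (Fin n) → ℝ} {x : EuclideanSpace ℝ (Fin n)}
    (hu : ContDiffAt ℝ 2 u x) (hv : ContDiffAt ℝ 2 v x)
    (hmax : IsLocalMax (fun z => u z - v z) x) (hg : ∇ u x ≠ 0) {lam mu : Fin n → ℝ}
    (hlam : IsEigenvalueVector (pHessian p u x) lam)
    (hmu : IsEigenvalueVector (pHessian p v x) mu) (hcone : lam ∈ gardingCone n k) :
    elemSymm k lam ≤ elemSymm k mu := by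
  have hgrad : ∇ u x = ∇ v x := gradient_eq_of_isLocalMax_sub
    (hu.differentiableAt two_ne_zero) (hv.differentiableAt two_ne_zero) hmax
  obtain ⟨Q, hQ, hPQ⟩ := exists_isHermitian_sq_eq hp hg
  have hpu : pHessian p u x = Q * Q * euclMatrix (fderiv ℝ (∇ u) x) := by
    rw [← hPQ, ← euclMatrix_comp, ← (hasFDerivAt_pGradient hu hg).fderiv]
    rfl
  have hpv : pHessian p v x = Q * Q * euclMatrix (fderiv ℝ (∇ v) x) := by
    rw [← hPQ, ← euclMatrix_comp, hgrad, ← (hasFDerivAt_pGradient hv (hgrad ▸ hg)).fderiv]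
    rfl
  -- `Q² H` need not be symmetric, but it has the characteristic polynomial of the symmetric matrix
  -- `Q H Q`. The gradients agree at `x`, so the same `Q` serves `u` and `v`.
  have hconj : ∀ H : Matrix (Fin n) (Fin n) ℝ, (Q * Q * H).charpoly = (Q * H * Q).charpoly := by
    intro H
    rw [mul_assoc, charpoly_mul_comm]
  have hsymm : ∀ {w : EuclideanSpace ℝ (Fin n) → ℝ}, ContDiffAt ℝ 2 w x →
      (euclMatrix (fderiv ℝ (∇ w) x)).IsHermitian := by
    intro w hw
    ext i j
    have := inner_fderiv_gradient_comm hw (EuclideanSpace.single i 1) (EuclideanSpace.single j 1)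
    simpa [euclMatrix, EuclideanSpace.inner_single_right] using this
  have hlam' : IsEigenvalueVector (Q * euclMatrix (fderiv ℝ (∇ u) x) * Q) lam :=
    hlam.congr (by rw [hpu, hconj])
  have hmu' : IsEigenvalueVector (Q * euclMatrix (fderiv ℝ (∇ v) x) * Q) mu :=
    hmu.congr (by rw [hpv, hconj])
  have hsand : ∀ {H : Matrix (Fin n) (Fin n) ℝ}, H.IsHermitian → (Q * H * Q).IsHermitian := by
    intro H hH
    unfold IsHermitian at *
    rw [conjTranspose_mul, conjTranspose_mul, hQ, hH, mul_assoc]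
  have hpsd : (euclMatrix (fderiv ℝ (∇ v) x) - euclMatrix (fderiv ℝ (∇ u) x)).PosSemidef := by
    refine PosSemidef.of_dotProduct_mulVec_nonneg ((hsymm hv).sub (hsymm hu)) fun y => ?_
    rw [star_trivial, sub_mulVec, dotProduct_sub, inner_eq_dotProduct_euclMatrix,
      inner_eq_dotProduct_euclMatrix, inner_fderiv_gradient hv, inner_fderiv_gradient hu]
    have h1 := fderiv_fderiv_nonpos_of_isLocalMax (hu.sub hv) hmax (WithLp.toLp 2 y)
    have h2 : fderiv ℝ (fun z => u z - v z) =ᶠ[nhds x] fun z => fderiv ℝ u z - fderiv ℝ v z := by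
      filter_upwards [hu.eventually (by simp), hv.eventually (by simp)] with z h3 h4
      exact fderiv_fun_sub (h3.differentiableAt two_ne_zero) (h4.differentiableAt two_ne_zero)
    have h3 : ContDiffAt ℝ 1 (fderiv ℝ u) x := hu.fderiv_right (by norm_num)
    have h4 : ContDiffAt ℝ 1 (fderiv ℝ v) x := hv.fderiv_right (by norm_num)
    change fderiv ℝ (fderiv ℝ (fun z => u z - v z)) x _ _ ≤ 0 at h1
    rw [h2.fderiv_eq, fderiv_fun_sub (h3.differentiableAt one_ne_zero)
      (h4.differentiableAt one_ne_zero)] at h1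
    simp only [_root_.sub_apply] at h1
    linarith
  have hpsd' : (Q * euclMatrix (fderiv ℝ (∇ v) x) * Q -
      Q * euclMatrix (fderiv ℝ (∇ u) x) * Q).PosSemidef := by
    have := hpsd.conjTranspose_mul_mul_same Q
    rwa [hQ, mul_sub, sub_mul] at this
  rw [hlam'.elemSymm_eq, hmu'.elemSymm_eq]
  refine coeff_detOneAdd_le_of_posSemidef_sub (hsand (hsymm hu)) hpsd' (k := k) ?_ k le_rfl
  intro j hj
  rw [← hlam'.elemSymm_eq]
  exact hcone j hj

end ComparisonMatrix

/-! ### Autonomous equations solved by separation of variables. -/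

section AutonomousODE

open Filter Set

variable {G : ℝ → ℝ}

theorem tendsto_integral_inv_atTop_of_le (hG : Continuous G) (hpos : ∀ s, 0 < G s) {a M : ℝ}
    (hM : ∀ s, a ≤ s → G s ≤ M) : Tendsto (fun s => ∫ r in a..s, (G r)⁻¹) atTop atTop := by
  have hM0 : 0 < M := (hpos a).trans_le (hM a le_rfl)
  have hlin : Tendsto (fun s => (s - a) * M⁻¹) atTop atTop :=
    (tendsto_atTop_add_const_right _ (-a) tendsto_id).atTop_mul_const (inv_pos.2 hM0)
  refine tendsto_atTop_mono' _ ?_ hlin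
  filter_upwards [eventually_ge_atTop a] with s hs
  have hc : Continuous fun r => (G r)⁻¹ := hG.inv₀ fun r => (hpos r).ne'
  have := intervalIntegral.integral_mono_on (μ := volume) hs (f := fun _ => M⁻¹)
    intervalIntegrable_const (hc.intervalIntegrable a s)
    (fun r hr => inv_anti₀ (hpos r) (hM r hr.1))
  simpa using this

theorem tendsto_integral_inv_atBot_of_le (hG : Continuous G) (hpos : ∀ s, 0 < G s) {a M : ℝ}
    (hM : ∀ s, s ≤ a → G s ≤ M) : Tendsto (fun s => ∫ r in a..s, (G r)⁻¹) atBot atBot := by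
  have h := tendsto_integral_inv_atTop_of_le (G := fun s => G (-s)) (a := -a) (M := M)
    (hG.comp continuous_neg) (fun s => hpos _) (fun s hs => hM _ (by linarith))
  have h2 := tendsto_neg_atTop_atBot.comp (h.comp tendsto_neg_atBot_atTop)
  refine h2.congr fun s => ?_
  simp only [Function.comp]
  rw [intervalIntegral.integral_comp_neg (fun r => (G r)⁻¹), neg_neg, neg_neg,
    intervalIntegral.integral_symm, neg_neg]

/-- Global solvability of `Φ' = G(Φ)` by separation of variables. -/
theorem exists_hasDerivAt_comp_self (hG : Continuous G) (hpos : ∀ s, 0 < G s) (a : ℝ)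
    (hbot : Tendsto (fun s => ∫ r in a..s, (G r)⁻¹) atBot atBot)
    (htop : Tendsto (fun s => ∫ r in a..s, (G r)⁻¹) atTop atTop) :
    ∃ Φ : ℝ → ℝ, (∀ t, HasDerivAt Φ (G (Φ t)) t) ∧ StrictMono Φ ∧
      ∀ s, Φ (∫ r in a..s, (G r)⁻¹) = s := by
  have hc : Continuous fun r => (G r)⁻¹ := hG.inv₀ fun r => (hpos r).ne'
  -- `τ s` is the time at which the solution started at `a` takes the value `s`; the solution is its
  -- inverse.
  set τ : ℝ → ℝ := fun s => ∫ r in a..s, (G r)⁻¹ with hτ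
  have hder : ∀ s, HasDerivAt τ (G s)⁻¹ s := fun s => hc.integral_hasStrictDerivAt a s |>.hasDerivAt
  have hmono : StrictMono τ := strictMono_of_deriv_pos fun s => by
    rw [(hder s).deriv]; exact inv_pos.2 (hpos s)
  have hcont : Continuous τ := continuous_iff_continuousAt.2 fun s => (hder s).continuousAt
  have hsurj : Function.Surjective τ := hcont.surjective htop hbot
  let e := hmono.orderIsoOfSurjective τ hsurj
  have hleft : ∀ s, e.symm (τ s) = s := fun s => e.symm_apply_apply s
  have hright : ∀ t, τ (e.symm t) = t := fun t => e.apply_symm_apply t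
  refine ⟨e.symm, fun t => ?_, e.symm.strictMono, hleft⟩
  have := HasDerivAt.of_local_left_inverse (f := τ) (g := e.symm) (a := t)
    e.symm.continuous.continuousAt (hder _) (inv_ne_zero (hpos _).ne')
    (Eventually.of_forall hright)
  simpa using this

end AutonomousODE

/-! ### The speed `G` of a profile, built from a primitive of `g`. -/

section Speed

/-- The right-hand side of the first-order equation for the radial profiles; up to constants,
`(G^{q+1})' = g`. -/
noncomputable def speed (q A D : ℝ) (g : ℝ → ℝ) (a s : ℝ) : ℝ :=
  D * (A + ∫ r in a..s, g r) ^ (1 / (q + 1))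

/-- The derivative of `speed`. -/
noncomputable def speedDeriv (q A D : ℝ) (g : ℝ → ℝ) (a s : ℝ) : ℝ :=
  D * (g s * (1 / (q + 1)) * (A + ∫ r in a..s, g r) ^ (1 / (q + 1) - 1))

variable {q A D a : ℝ} {g : ℝ → ℝ}

/-- Since `g` vanishes to the left of `a`, the base of the powers in `speed` stays at least `A > 0`
on the whole line. -/
theorem integral_nonneg_of_eq_zero_Iic (h0 : ∀ s, 0 ≤ g s)
    (ha : ∀ s ≤ a, g s = 0) (s : ℝ) : 0 ≤ ∫ r in a..s, g r := by
  rcases le_total a s with h | h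
  · exact intervalIntegral.integral_nonneg h fun r _ => h0 r
  · rw [intervalIntegral.integral_symm, intervalIntegral.integral_congr (g := fun _ => (0 : ℝ))]
    · simp
    · intro r hr
      rw [Set.uIcc_of_le h] at hr
      exact ha r hr.2

theorem integral_eq_zero_of_le (ha : ∀ s ≤ a, g s = 0) {s : ℝ} (h : s ≤ a) :
    ∫ r in a..s, g r = 0 := by
  rw [intervalIntegral.integral_symm, intervalIntegral.integral_congr (g := fun _ => (0 : ℝ))]
  · simp
  · intro r hr
    rw [Set.uIcc_of_le h] at hr
    exact ha r hr.2

theorem hasDerivAt_speed (hg : Continuous g) (h0 : ∀ s, 0 ≤ g s) (ha : ∀ s ≤ a, g s = 0)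
    (hA : 0 < A) (s : ℝ) : HasDerivAt (speed q A D g a) (speedDeriv q A D g a s) s := by
  have h1 : HasDerivAt (fun s => A + ∫ r in a..s, g r) (g s) s :=
    ((hg.integral_hasStrictDerivAt a s).hasDerivAt).const_add A
  have h2 := integral_nonneg_of_eq_zero_Iic h0 ha s
  exact (h1.rpow_const (p := 1 / (q + 1)) (Or.inl (by positivity))).const_mul D

theorem continuous_speed (hg : Continuous g) (h0 : ∀ s, 0 ≤ g s) (ha : ∀ s ≤ a, g s = 0)
    (hA : 0 < A) : Continuous (speed q A D g a) :=
  continuous_iff_continuousAt.2 fun s => (hasDerivAt_speed hg h0 ha hA s).continuousAt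

theorem continuous_speedDeriv (hg : Continuous g) (h0 : ∀ s, 0 ≤ g s) (ha : ∀ s ≤ a, g s = 0)
    (hA : 0 < A) : Continuous (speedDeriv q A D g a) := by
  have h1 : Continuous fun s => A + ∫ r in a..s, g r := continuous_iff_continuousAt.2 fun s =>
    (((hg.integral_hasStrictDerivAt a s).hasDerivAt).const_add A).continuousAt
  refine continuous_const.mul ((hg.mul continuous_const).mul
    (h1.rpow_const fun s => Or.inl ?_))
  have h2 := integral_nonneg_of_eq_zero_Iic h0 ha s
  positivity

theorem speed_pos (h0 : ∀ s, 0 ≤ g s) (ha : ∀ s ≤ a, g s = 0) (hA : 0 < A) (hD : 0 < D) (s : ℝ) :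
    0 < speed q A D g a s := by
  have h2 := integral_nonneg_of_eq_zero_Iic h0 ha s
  unfold speed
  positivity

theorem speedDeriv_nonneg (h0 : ∀ s, 0 ≤ g s) (ha : ∀ s ≤ a, g s = 0) (hA : 0 < A) (hD : 0 < D)
    (hq : 0 < q) (s : ℝ) : 0 ≤ speedDeriv q A D g a s := by
  have h2 := integral_nonneg_of_eq_zero_Iic h0 ha s
  have := h0 s
  unfold speedDeriv
  positivity

theorem speed_rpow (h0 : ∀ s, 0 ≤ g s) (ha : ∀ s ≤ a, g s = 0) (hA : 0 < A) (hD : 0 < D)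
    (s : ℝ) : speed q A D g a s ^ q = D ^ q * (A + ∫ r in a..s, g r) ^ (q / (q + 1)) := by
  have h2 := integral_nonneg_of_eq_zero_Iic h0 ha s
  unfold speed
  rw [Real.mul_rpow hD.le (by positivity), ← Real.rpow_mul (by positivity)]
  congr 2
  ring

/-- The exponents `q/(q+1)` and `1/(q+1) - 1` cancel; this is the reason for the power `1/(q+1)` in
`speed`. -/
theorem speed_rpow_mul_speedDeriv (h0 : ∀ s, 0 ≤ g s) (ha : ∀ s ≤ a, g s = 0) (hA : 0 < A)
    (hD : 0 < D) (hq : 0 < q) (s : ℝ) :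
    speed q A D g a s ^ q * speedDeriv q A D g a s = D ^ (q + 1) / (q + 1) * g s := by
  have h2 := integral_nonneg_of_eq_zero_Iic h0 ha s
  rw [speed_rpow h0 ha hA hD, speedDeriv, Real.rpow_add hD, Real.rpow_one]
  have h3 : (A + ∫ r in a..s, g r) ^ (q / (q + 1)) * (A + ∫ r in a..s, g r) ^ (1 / (q + 1) - 1)
      = 1 := by
    rw [← Real.rpow_add (by positivity), show q / (q + 1) + (1 / (q + 1) - 1) = 0 by
      field_simp; ring, Real.rpow_zero]
  linear_combination (D ^ q * D * g s * (1 / (q + 1))) * h3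

theorem speed_of_le (ha : ∀ s ≤ a, g s = 0) {s : ℝ} (hs : s ≤ a) :
    speed q A D g a s = D * A ^ (1 / (q + 1)) := by
  rw [speed, integral_eq_zero_of_le ha hs, add_zero]

end Speed

/-! ### Radial functions: gradient and eigenvalues. -/

section Radial

open scoped RealInnerProductSpace Gradient
open Matrix

variable {n : ℕ}

/-- The radial function `Φ(|x - y|^{1+m} / (1+m))`. -/
noncomputable def radialFun (Φ : ℝ → ℝ) (m : ℝ) (y x : EuclideanSpace ℝ (Fin n)) : ℝ :=
  Φ (‖x - y‖ ^ (1 + m) / (1 + m))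

variable {Φ G G' : ℝ → ℝ} {m : ℝ} {y : EuclideanSpace ℝ (Fin n)}

/-- Bootstrap: `Φ' = G ∘ Φ` is as regular as `G` and `Φ`, hence `C¹`. -/
theorem contDiff_two_of_hasDerivAt_comp (hG : ∀ s, HasDerivAt G (G' s) s) (hG' : Continuous G')
    (hΦ : ∀ t, HasDerivAt Φ (G (Φ t)) t) : ContDiff ℝ 2 Φ := by
  have hGc : ContDiff ℝ 1 G := contDiff_one_iff_deriv.2
    ⟨fun s => (hG s).differentiableAt, by rwa [show deriv G = G' from funext fun s => (hG s).deriv]⟩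
  have hd : deriv Φ = fun t => G (Φ t) := funext fun t => (hΦ t).deriv
  have hΦd : Differentiable ℝ Φ := fun t => (hΦ t).differentiableAt
  have hΦ1 : ContDiff ℝ 1 Φ := contDiff_one_iff_deriv.2
    ⟨hΦd, by rw [hd]; exact hGc.continuous.comp hΦd.continuous⟩
  rw [show (2 : ℕ∞ω) = 1 + 1 by norm_num, contDiff_succ_iff_deriv]
  refine ⟨hΦd, by simp, ?_⟩
  rw [hd]
  exact hGc.comp hΦ1

/-- The exponent `1 + m` exceeds `1`, so the centre `x = y` is included. -/
theorem hasGradientAt_radialFun (hm : 0 < m) (hΦ : ∀ t, HasDerivAt Φ (G (Φ t)) t)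
    (x : EuclideanSpace ℝ (Fin n)) :
    HasGradientAt (radialFun Φ m y)
      ((G (radialFun Φ m y x) * ‖x - y‖ ^ (m - 1)) • (x - y)) x := by
  have h0 : HasFDerivAt (fun z : EuclideanSpace ℝ (Fin n) => z - y)
      (ContinuousLinearMap.id ℝ _) x := (hasFDerivAt_id x).sub_const y
  have h1 := (hasFDerivAt_norm_rpow (x - y) (p := 1 + m) (by linarith)).comp x h0
  have h2 := (hΦ (‖x - y‖ ^ (1 + m) / (1 + m))).comp_hasFDerivAt x (h1.mul_const (1 + m)⁻¹)
  rw [hasGradientAt_iff_hasFDerivAt]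
  refine HasFDerivAt.congr_fderiv (f := radialFun Φ m y) h2 ?_
  ext1 h
  have : (1 + m) ≠ 0 := by positivity
  simp only [FunLike.coe_smul, ContinuousLinearMap.coe_comp, Pi.smul_apply,
    Function.comp, innerSL_apply_apply, InnerProductSpace.toDual_apply_apply, inner_smul_left,
    smul_eq_mul, ContinuousLinearMap.coe_id', id, radialFun, show 1 + m - 2 = m - 1 by ring,
    conj_trivial]
  field_simp

theorem gradient_radialFun (hm : 0 < m) (hΦ : ∀ t, HasDerivAt Φ (G (Φ t)) t)
    (x : EuclideanSpace ℝ (Fin n)) :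
    ∇ (radialFun Φ m y) x = (G (radialFun Φ m y x) * ‖x - y‖ ^ (m - 1)) • (x - y) :=
  (hasGradientAt_radialFun hm hΦ x).gradient

theorem contDiff_radialFun {l : ℕ∞ω} (hΦ : ContDiff ℝ l Φ)
    (h : ContDiff ℝ l fun z : EuclideanSpace ℝ (Fin n) => ‖z‖ ^ (1 + m)) :
    ContDiff ℝ l (radialFun Φ m y) :=
  hΦ.comp ((h.comp (contDiff_id.sub contDiff_const)).div_const _)

theorem contDiffAt_radialFun {l : ℕ∞ω} (hΦ : ContDiff ℝ l Φ) {x : EuclideanSpace ℝ (Fin n)}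
    (hx : x ≠ y) : ContDiffAt ℝ l (radialFun Φ m y) x := by
  have hxy : x - y ≠ 0 := sub_ne_zero.2 hx
  have h1 : ContDiffAt ℝ l (fun z => ‖z - y‖) x :=
    (contDiffAt_norm ℝ hxy).comp x (contDiffAt_id.sub contDiffAt_const)
  exact hΦ.contDiffAt.comp x
    ((h1.rpow_const_of_ne (norm_ne_zero_iff.2 hxy)).div_const _)

theorem norm_gradient_radialFun (hm : 0 < m) (hGpos : ∀ s, 0 < G s)
    (hΦ : ∀ t, HasDerivAt Φ (G (Φ t)) t) (x : EuclideanSpace ℝ (Fin n)) (hx : x ≠ y) :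
    ‖∇ (radialFun Φ m y) x‖ = G (radialFun Φ m y x) * ‖x - y‖ ^ m := by
  have hr : 0 < ‖x - y‖ := norm_pos_iff.2 (sub_ne_zero.2 hx)
  have := hGpos (radialFun Φ m y x)
  rw [gradient_radialFun hm hΦ, norm_smul, Real.norm_of_nonneg (by positivity), mul_assoc,
    Real.rpow_sub_one hr.ne', div_mul_cancel₀ _ hr.ne']

/-- The derivative of `|Du|^{p-2} Du` for a radial function and its eigenvalues. -/
theorem pHessian_radialFun {p : ℝ} (hm : 0 < m) (hG : ∀ s, HasDerivAt G (G' s) s)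
    (hGpos : ∀ s, 0 < G s) (hΦ : ∀ t, HasDerivAt Φ (G (Φ t)) t)
    {x : EuclideanSpace ℝ (Fin n)} (hx : x ≠ y) (i₀ : Fin n) {w w' : ℝ}
    (hw : w = (G (radialFun Φ m y x) * ‖x - y‖ ^ m) ^ (p - 1))
    (hw' : w' = (p - 1) * w * (G' (radialFun Φ m y x) * ‖x - y‖ ^ m + m / ‖x - y‖)) :
    DifferentiableAt ℝ (pGradient p (radialFun Φ m y)) x ∧
      IsEigenvalueVector (pHessian p (radialFun Φ m y) x)
        (fun i => if i = i₀ then w' else w / ‖x - y‖) := by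
  -- `W(r)` is the modulus of `|Du|^{p-2} Du`, so this field is `(W(r)/r)(x - y)`. Its derivative
  -- has the eigenvalue `W'` in the radial direction and `W/r` in the tangential ones.
  set W : ℝ → ℝ := fun r => (G (Φ (r ^ (1 + m) / (1 + m))) * r ^ m) ^ (p - 1) with hW
  have hxy : x - y ≠ 0 := sub_ne_zero.2 hx
  set r := ‖x - y‖ with hr
  have hr0 : 0 < r := norm_pos_iff.2 hxy
  have hWd : HasDerivAt W w' r := by
    have h1 : HasDerivAt (fun r : ℝ => r ^ (1 + m) / (1 + m)) (r ^ m) r := by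
      have := (Real.hasDerivAt_rpow_const (x := r) (p := 1 + m) (Or.inl hr0.ne')).div_const (1 + m)
      refine this.congr_deriv ?_
      rw [show 1 + m - 1 = m by ring]
      field_simp
    have h2 := (hG _).comp r ((hΦ _).comp r h1)
    have h3 := h2.mul (Real.hasDerivAt_rpow_const (x := r) (p := m) (Or.inl hr0.ne'))
    have hpos : 0 < G (Φ (r ^ (1 + m) / (1 + m))) * r ^ m := mul_pos (hGpos _) (by positivity)
    have h4 := h3.rpow_const (p := p - 1) (Or.inl hpos.ne')
    have h5 : HasDerivAt W _ r := h4
    refine h5.congr_deriv ?_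
    rw [hw', hw]
    simp only [Function.comp, radialFun, Pi.mul_apply, ← hr]
    rw [Real.rpow_sub_one hpos.ne' (p - 1), Real.rpow_sub_one hr0.ne']
    have := hGpos (Φ (r ^ (1 + m) / (1 + m)))
    have := Real.rpow_pos_of_pos hr0 m
    field_simp
  have hWr : W r = w := by rw [hw]; rfl
  have hχ : HasDerivAt (fun r => W r / r) (w' / r - w / r ^ 2) r := by
    have := hWd.div (hasDerivAt_id r) hr0.ne'
    refine this.congr_deriv ?_
    simp only [id, hWr]
    field_simp
  have hfield : pGradient p (radialFun Φ m y) =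
      fun z => (fun z : EuclideanSpace ℝ (Fin n) => (W ‖z‖ / ‖z‖) • z) (z - y) := by
    ext1 z
    by_cases hz : z = y
    · simp [pGradient, hz, gradient_radialFun hm hΦ]
    · have hz0 : 0 < ‖z - y‖ := norm_pos_iff.2 (sub_ne_zero.2 hz)
      unfold pGradient
      rw [norm_gradient_radialFun hm hGpos hΦ z hz, gradient_radialFun hm hΦ, smul_smul]
      congr 1
      have hpos : 0 < G (radialFun Φ m y z) * ‖z - y‖ ^ m := mul_pos (hGpos _) (by positivity)
      change _ = (G (radialFun Φ m y z) * ‖z - y‖ ^ m) ^ (p - 1) / ‖z - y‖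
      rw [show p - 2 = p - 1 - 1 by ring, Real.rpow_sub_one hpos.ne', Real.rpow_sub_one hz0.ne']
      have := hGpos (radialFun Φ m y z)
      have := Real.rpow_pos_of_pos hz0 m
      field_simp
  have hF : HasFDerivAt (pGradient p (radialFun Φ m y))
      ((w / r) • ContinuousLinearMap.id ℝ _ +
        ((w' / r - w / r ^ 2) / r) • (innerSL ℝ (x - y)).smulRight (x - y)) x := by
    rw [hfield]
    have h1 := hasFDerivAt_radial_smul hxy hχ
    rw [← hr, hWr] at h1
    exact h1.comp x ((hasFDerivAt_id x).sub_const y)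
  refine ⟨hF.differentiableAt, ?_⟩
  have hmat : pHessian p (radialFun Φ m y) x =
      euclMatrix (fderiv ℝ (pGradient p (radialFun Φ m y)) x) := rfl
  rw [hmat, hF.fderiv, euclMatrix_radial]
  convert isEigenvalueVector_smul_one_add_vecMulVec _ _ _ i₀ using 3
  have hdot : (x - y).ofLp ⬝ᵥ (x - y).ofLp = r ^ 2 := by
    rw [hr, EuclideanSpace.norm_sq_eq]
    simp [dotProduct, sq]
  rw [smul_dotProduct, hdot, smul_eq_mul]
  field_simp
  ring

end Radial

/-! ### Reduction of the integral condition with exponent `κ`. -/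

section KellerOssermanCondition

open Filter Set

/-- By monotonicity `(t/2) h(t) ≤ ∫_{t/2}^t h`, and the right-hand side tends to zero. -/
theorem eventually_mul_le_one_of_antitoneOn {h : ℝ → ℝ} {c : ℝ}
    (hanti : AntitoneOn h (Ioi c)) (hint : IntegrableOn h (Ioi c)) :
    ∀ᶠ t in atTop, t * h t ≤ 1 := by
  have h1 : Tendsto (fun t => ∫ s in (c + 1)..t, h s) atTop (nhds (∫ s in Ioi (c + 1), h s)) :=
    intervalIntegral_tendsto_integral_Ioi _ (hint.mono_set (Ioi_subset_Ioi (by linarith)))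
      tendsto_id
  have hhalf : Tendsto (fun t : ℝ => t / 2) atTop atTop := tendsto_id.atTop_div_const two_pos
  have h2 := h1.sub (h1.comp hhalf)
  rw [sub_self] at h2
  have h3 := h2.eventually (gt_mem_nhds (show (0 : ℝ) < 1 / 2 by norm_num))
  filter_upwards [h3, eventually_gt_atTop 0, hhalf.eventually (eventually_gt_atTop (c + 1)),
    eventually_gt_atTop (c + 1)] with t ht h0 hc hc'
  simp only [Function.comp] at ht
  have hii : ∀ {x y : ℝ}, c < x → c < y → IntervalIntegrable h volume x y := fun hx hy =>
    (hint.mono_set (fun z hz => by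
      rw [uIcc, mem_Icc] at hz
      exact lt_of_lt_of_le (lt_min hx hy) hz.1)).intervalIntegrable
  rw [intervalIntegral.integral_interval_sub_left (hii (by linarith) (by linarith))
    (hii (by linarith) (by linarith))] at ht
  have h4 := intervalIntegral.integral_mono_on (μ := volume) (by linarith : t / 2 ≤ t)
    (f := fun _ => h t) intervalIntegrable_const (hii (by linarith) (by linarith))
    (fun s hs => hanti (show c < s by linarith [hs.1]) (show c < t by linarith) hs.2)
  rw [intervalIntegral.integral_const, smul_eq_mul] at h4
  linarith

theorem tendsto_integral_inv_atTop_of_not_integrableOn {G h : ℝ → ℝ} (hG : Continuous G)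
    (hpos : ∀ s, 0 < G s) (a : ℝ) {K : ℝ} (h0 : ∀ t ∈ Ioi (1 : ℝ), 0 ≤ h t)
    (hle : ∀ t ∈ Ioi (1 : ℝ), h t ≤ K * (G t)⁻¹)
    (hmeas : AEStronglyMeasurable h (volume.restrict (Ioi 1))) (hnot : ¬ IntegrableOn h (Ioi 1)) :
    Tendsto (fun t => ∫ s in a..t, (G s)⁻¹) atTop atTop := by
  have hc : Continuous fun r => (G r)⁻¹ := hG.inv₀ fun r => (hpos r).ne'
  have hii : ∀ x y, IntervalIntegrable (fun r => (G r)⁻¹) volume x y := fun x y =>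
    hc.intervalIntegrable x y
  have hmono : Monotone fun t => ∫ s in a..t, (G s)⁻¹ := by
    intro x y hxy
    have h1 := intervalIntegral.integral_add_adjacent_intervals (hii a x) (hii x y)
    have h2 := intervalIntegral.integral_nonneg (μ := volume) hxy
      (fun s _ => (inv_pos.2 (hpos s)).le)
    dsimp only
    linarith
  refine tendsto_atTop_atTop_of_monotone' hmono fun ⟨B, hB⟩ => hnot ?_
  have hGi : IntegrableOn (fun r => (G r)⁻¹) (Ioi 1) := by
    refine integrableOn_Ioi_of_intervalIntegral_norm_bounded (B - ∫ s in a..1, (G s)⁻¹) 1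
      (b := fun t : ℝ => t) (l := atTop) (fun t => (hii 1 t).1) tendsto_id ?_
    refine Eventually.of_forall fun t => ?_
    have h1 := intervalIntegral.integral_add_adjacent_intervals (hii a 1) (hii 1 t)
    have h2 := hB (mem_range_self t)
    simp only [Real.norm_of_nonneg (inv_pos.2 (hpos _)).le]
    linarith
  refine Integrable.mono' (hGi.const_mul K) hmeas ?_
  refine (ae_restrict_iff' measurableSet_Ioi).2 (Eventually.of_forall fun t ht => ?_)
  rw [Real.norm_of_nonneg (h0 t ht)]
  exact hle t ht

variable {g : ℝ → ℝ} {q κ : ℝ}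

/-- Integrability of this decreasing function would force `g(t) ≥ t^q` for large `t`. Under that
growth the integrand with `κ` is, up to a rescaling of `t`, the smaller one. -/
theorem not_integrableOn_of_kellerOsserman (hg : Continuous g) (hmono : Monotone g)
    (hpos : ∀ t, 0 < g t) (hq : 0 < q) (hκ : 1 ≤ κ)
    (hKO : KellerOsserman (fun s => g s ^ κ) (κ * q)) :
    ¬ IntegrableOn (fun t => (t * g t) ^ (-(1 / (q + 1)))) (Ioi 1) := by
  intro hint
  have hanti : AntitoneOn (fun t => (t * g t) ^ (-(1 / (q + 1)))) (Ioi 1) := by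
    intro s hs t ht hst
    have hs0 : (0 : ℝ) < s := one_pos.trans hs
    refine Real.rpow_le_rpow_of_nonpos (mul_pos hs0 (hpos s)) ?_ ?_
    · exact mul_le_mul hst (hmono hst) (hpos s).le (hs0.le.trans hst)
    · have : 0 < 1 / (q + 1) := by positivity
      linarith
  obtain ⟨t₀, ht₀⟩ := eventually_atTop.1 (eventually_mul_le_one_of_antitoneOn hanti hint)
  set c := max t₀ 1 with hc
  have hc1 : 1 ≤ c := le_max_right _ _
  have hgrow : ∀ t, c ≤ t → t ^ q ≤ g t := by
    intro t ht
    have ht1 : 0 < t := by linarith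
    have h1 := ht₀ t ((le_max_left _ _).trans ht)
    have h2 : t ≤ (t * g t) ^ (1 / (q + 1)) := by
      have h3 : 0 < (t * g t) ^ (1 / (q + 1)) := Real.rpow_pos_of_pos (mul_pos ht1 (hpos t)) _
      rw [Real.rpow_neg (mul_pos ht1 (hpos t)).le, ← div_eq_mul_inv, div_le_one h3] at h1
      exact h1
    have h3 : t ^ (q + 1) ≤ t * g t := by
      have := Real.rpow_le_rpow ht1.le h2 (by positivity : 0 ≤ q + 1)
      rwa [← Real.rpow_mul (mul_pos ht1 (hpos t)).le, one_div_mul_cancel (by positivity),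
        Real.rpow_one] at this
    rw [Real.rpow_add_one ht1.ne', mul_comm] at h3
    exact le_of_mul_le_mul_left h3 ht1
  -- After raising to the power `(q+1)(κq+1)` this is `(s^q)^{κ-1} ≤ g^{κ-1}`; here `κ ≥ 1` enters.
  have hcomp : ∀ s, c ≤ s → (s * g s ^ κ) ^ (-(1 / (κ * q + 1))) ≤
      (s * g s) ^ (-(1 / (q + 1))) := by
    intro s hs
    have hs0 : 0 < s := by linarith
    have hgs := hpos s
    have hκq : 0 < κ * q := by positivity
    rw [Real.rpow_neg (by positivity), Real.rpow_neg (by positivity)]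
    refine inv_anti₀ (by positivity) ?_
    have h1 : (s * g s) ^ (κ * q + 1) ≤ (s * g s ^ κ) ^ (q + 1) := by
      rw [Real.mul_rpow hs0.le hgs.le, Real.mul_rpow hs0.le (by positivity),
        ← Real.rpow_mul hgs.le, show κ * q + 1 = (q + 1) + q * (κ - 1) by ring,
        Real.rpow_add hs0, Real.rpow_mul hs0.le, mul_assoc]
      refine mul_le_mul_of_nonneg_left ?_ (by positivity)
      calc (s ^ q) ^ (κ - 1) * g s ^ (q + 1 + q * (κ - 1))
          ≤ g s ^ (κ - 1) * g s ^ (q + 1 + q * (κ - 1)) := by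
            refine mul_le_mul_of_nonneg_right ?_ (by positivity)
            exact Real.rpow_le_rpow (by positivity) (hgrow s hs) (by linarith)
        _ = g s ^ (κ * (q + 1)) := by
            rw [← Real.rpow_add hgs]; congr 1; ring
    have h2 := Real.rpow_le_rpow (by positivity) h1
      (show 0 ≤ 1 / ((q + 1) * (κ * q + 1)) by positivity)
    rw [← Real.rpow_mul (by positivity), ← Real.rpow_mul (by positivity)] at h2
    have hq1 : q + 1 ≠ 0 := by positivity
    have hκ1 : κ * q + 1 ≠ 0 := by positivity
    rwa [show (κ * q + 1) * (1 / ((q + 1) * (κ * q + 1))) = 1 / (q + 1) by field_simp,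
      show (q + 1) * (1 / ((q + 1) * (κ * q + 1))) = 1 / (κ * q + 1) by field_simp] at h2
  -- The dilation by `1/2` is there because `∫_0^t g^κ ≥ (t/2) g(t/2)^κ`.
  have hscale : IntegrableOn (fun t => ((1 / 2 * t) * g (1 / 2 * t)) ^ (-(1 / (q + 1))))
      (Ioi (2 * c)) := by
    rw [integrableOn_Ioi_comp_mul_left_iff (fun t => (t * g t) ^ (-(1 / (q + 1)))) (2 * c)
      (by norm_num : (0 : ℝ) < 1 / 2)]
    exact hint.mono_set (Ioi_subset_Ioi (by linarith))
  have hfin := hscale.lintegral_lt_top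
  have hgκ : Continuous fun s => g s ^ κ := hg.rpow_const fun s => Or.inl (hpos s).ne'
  refine absurd (hKO (2 * c) (by linarith)) (ne_of_lt (lt_of_le_of_lt ?_ hfin))
  refine setLIntegral_mono' measurableSet_Ioi fun t ht => ENNReal.ofReal_le_ofReal ?_
  have ht' : 2 * c < t := ht
  refine le_trans ?_ (hcomp (1 / 2 * t) (by linarith))
  refine Real.rpow_le_rpow_of_nonpos ?_ ?_ ?_
  · have := hpos (1 / 2 * t)
    have : 0 < 1 / 2 * t := by linarith
    positivity
  · have h1 := intervalIntegral.integral_add_adjacent_intervals (μ := volume)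
      (hgκ.intervalIntegrable 0 (1 / 2 * t)) (hgκ.intervalIntegrable (1 / 2 * t) t)
    have h2 := intervalIntegral.integral_nonneg (μ := volume) (by linarith : 0 ≤ 1 / 2 * t)
      (fun s _ => (Real.rpow_pos_of_pos (hpos s) κ).le)
    have h3 := intervalIntegral.integral_mono_on (μ := volume) (by linarith : 1 / 2 * t ≤ t)
      (f := fun _ => g (1 / 2 * t) ^ κ) intervalIntegrable_const
      (hgκ.intervalIntegrable (1 / 2 * t) t)
      (fun s hs => Real.rpow_le_rpow (hpos _).le (hmono hs.1) (by linarith))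
    rw [intervalIntegral.integral_const, smul_eq_mul] at h3
    nlinarith
  · have : 0 < 1 / (κ * q + 1) := by positivity
    linarith

end KellerOssermanCondition

/-! ### Two-sided bounds for `S_k` at a radial eigenvalue vector. -/

section RadialEigenvalues

variable {n k : ℕ} {a b : ℝ}

theorem prod_ite_eq_of_card {i₀ : Fin n} {s : Finset (Fin n)} (hs : s.card = k) :
    ∏ i ∈ s, (if i = i₀ then a else b) = if i₀ ∈ s then a * b ^ (k - 1) else b ^ k := by
  split_ifs with h
  · rw [← Finset.mul_prod_erase s _ h, if_pos rfl, Finset.prod_congr rfl (g := fun _ => b)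
      (by intro i hi; simp [Finset.ne_of_mem_erase hi]), Finset.prod_const,
      Finset.card_erase_of_mem h, hs]
  · rw [Finset.prod_congr rfl (g := fun _ => b), Finset.prod_const, hs]
    intro i hi
    rw [if_neg]
    rintro rfl
    exact h hi

theorem mul_pow_le_elemSymm (hk : 1 ≤ k) (hkn : k ≤ n) (i₀ : Fin n) (ha : 0 ≤ a) (hb : 0 ≤ b) :
    a * b ^ (k - 1) ≤ elemSymm k (fun i => if i = i₀ then a else b) := by
  obtain ⟨s, hs, hc⟩ := Finset.exists_subsuperset_card_eq (n := k)
    (Finset.subset_univ ({i₀} : Finset (Fin n))) (by simpa using hk) (by simpa using hkn)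
  have hi : i₀ ∈ s := hs (Finset.mem_singleton_self i₀)
  unfold elemSymm
  have h1 := Finset.single_le_sum (f := fun s => ∏ i ∈ s, (if i = i₀ then a else b))
    (fun t _ => Finset.prod_nonneg fun i _ => by split_ifs <;> assumption)
    (Finset.mem_powersetCard.2 ⟨Finset.subset_univ s, hc.2⟩)
  rwa [prod_ite_eq_of_card hc.2, if_pos hi] at h1

theorem elemSymm_le_two_pow_mul (i₀ : Fin n) (ha : 0 ≤ a) (hb : 0 ≤ b) :
    elemSymm k (fun i => if i = i₀ then a else b) ≤ 2 ^ n * (a * b ^ (k - 1) + b ^ k) := by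
  unfold elemSymm
  have h1 := Finset.sum_le_card_nsmul (Finset.powersetCard k (Finset.univ : Finset (Fin n)))
    (fun s => ∏ i ∈ s, (if i = i₀ then a else b)) (a * b ^ (k - 1) + b ^ k) (by
      intro s hs
      rw [prod_ite_eq_of_card (Finset.mem_powersetCard.1 hs).2]
      split_ifs
      · exact le_add_of_nonneg_right (by positivity)
      · exact le_add_of_nonneg_left (by positivity))
  refine h1.trans ?_
  rw [nsmul_eq_mul]
  refine mul_le_mul_of_nonneg_right ?_ (by positivity)
  have : (Finset.powersetCard k (Finset.univ : Finset (Fin n))).card ≤ 2 ^ n := by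
    rw [Finset.card_powersetCard, Finset.card_univ, Fintype.card_fin]
    exact Nat.choose_le_two_pow n k
  exact_mod_cast this

theorem mem_gardingCone_of_pos (hkn : k ≤ n) {lam : Fin n → ℝ} (h : ∀ i, 0 < lam i) :
    lam ∈ gardingCone n k := by
  intro j hj
  refine Finset.sum_pos (fun s _ => Finset.prod_pos fun i _ => h i) ?_
  rw [Finset.powersetCard_nonempty]
  have := (Finset.mem_Icc.1 hj).2
  simpa using this.trans hkn

/-- The powers of the modulus of a radial profile. -/
theorem rpow_sub_one_pow_eq {p β m q G r : ℝ} (hG : 0 < G) (hr : 0 < r)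
    (hq : q = k * (p - β - 1)) :
    ((G * r ^ m) ^ (p - 1)) ^ k = ((G * r ^ m) ^ β) ^ k * (G ^ q * r ^ (m * q)) := by
  have hN : 0 < G * r ^ m := by positivity
  rw [Real.rpow_mul hr.le, ← Real.mul_rpow hG.le (by positivity), ← Real.rpow_natCast,
    ← Real.rpow_natCast, ← Real.rpow_mul hN.le, ← Real.rpow_mul hN.le, ← Real.rpow_add hN, hq]
  congr 1
  ring

end RadialEigenvalues

/-! ### Construction of the entire radial subsolution. -/

section Subsolution

open scoped Gradient

variable {n k : ℕ} {p α β m q : ℝ} {f Φ G G' : ℝ → ℝ}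

/-- Since `k(p-1) = kβ + q`, the power `N^{k(p-1)}` splits into the factor `|Du|^{βk}` of the
equation and `N^q = s^q r^{mq}`. -/
theorem radial_eigenvalue_mul_pow_eq {N W r s : ℝ} (hk : 1 ≤ k) (hs : 0 < s) (hr : 0 < r)
    (hq : q = k * (p - β - 1)) (hN : N = s * r ^ m) (hW : W = N ^ (p - 1)) (c : ℝ) :
    ((p - 1) * W * (c * r ^ m + m / r)) * (W / r) ^ (k - 1) =
      (N ^ β) ^ k * (s ^ q * r ^ (m * q) / r ^ k) * ((p - 1) * (c * r ^ (m + 1) + m)) := by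
  have h1 := rpow_sub_one_pow_eq (m := m) hs hr hq
  rw [← hN, ← hW] at h1
  obtain ⟨l, rfl⟩ : ∃ l, k = l + 1 := ⟨k - 1, by omega⟩
  rw [mul_div_assoc', ← h1, Nat.add_sub_cancel, Real.rpow_add_one hr.ne', div_pow]
  field_simp
  ring

/-- A criterion for a radial function to be a subsolution. -/
theorem isEntireSubsolution_radialFun (hk : 1 ≤ k) (hkn : k ≤ n) (hp : 1 < p) (hm : 0 < m)
    (hq : q = k * (p - β - 1)) (hmq : m * q = k * (α + 1)) (hf_pos : ∀ t, 0 < f t)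
    (hG : ∀ s, HasDerivAt G (G' s) s) (hG' : Continuous G') (hGpos : ∀ s, 0 < G s)
    (hG'0 : ∀ s, 0 ≤ G' s) (hΦ : ∀ t, HasDerivAt Φ (G (Φ t)) t)
    (hineq : ∀ r, 0 < r → f (Φ (r ^ (1 + m) / (1 + m))) ^ k ≤
      (p - 1) * (G (Φ (r ^ (1 + m) / (1 + m))) ^ q *
        (G' (Φ (r ^ (1 + m) / (1 + m))) * r ^ (m + 1) + m))) :
    IsEntireSubsolution k p α β f
      (radialFun Φ m (0 : EuclideanSpace ℝ (Fin n))) := by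
  have hΦ2 := contDiff_two_of_hasDerivAt_comp hG hG' hΦ
  set u := radialFun Φ m (0 : EuclideanSpace ℝ (Fin n)) with hu
  have hnorm := fun x hx => norm_gradient_radialFun (y := (0 : EuclideanSpace ℝ (Fin n)))
    hm hGpos hΦ x hx
  simp only [← hu, sub_zero] at hnorm
  refine ⟨?_, ?_, ?_, ?_⟩
  · exact contDiff_radialFun (hΦ2.of_le (by norm_num)) (contDiff_norm_rpow (by linarith))
  · exact fun x hx => (contDiffAt_radialFun hΦ2 hx).contDiffWithinAt
  · rintro ⟨c, hc⟩
    set x : EuclideanSpace ℝ (Fin n) := EuclideanSpace.single ⟨0, by omega⟩ 1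
    have hx1 : ‖x‖ = 1 := by simp [x]
    have hx0 : x ≠ 0 := by rw [← norm_ne_zero_iff, hx1]; exact one_ne_zero
    have h1 := hnorm x hx0
    rw [show u = fun _ => c from funext hc] at h1
    have h2 := hGpos c
    simp [gradient, hx1] at h1
    linarith
  · intro x hx
    obtain ⟨hd, he⟩ := pHessian_radialFun (p := p) hm hG hGpos hΦ hx ⟨0, by omega⟩ rfl rfl
    rw [← hu, sub_zero] at he
    have hr : 0 < ‖x‖ := norm_pos_iff.2 hx
    have hs := hGpos (u x)
    have hc := hG'0 (u x)
    have hN := hnorm x hx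
    rw [← hN] at he
    set r := ‖x‖ with hrdef
    set N := ‖∇ u x‖ with hNdef
    have hN0 : 0 < N := by rw [hN]; positivity
    have hW0 : 0 < N ^ (p - 1) := by positivity
    have hp1 : 0 < p - 1 := by linarith
    refine ⟨hd, _, he, ?_, ?_⟩
    · refine mem_gardingCone_of_pos hkn fun i => ?_
      split_ifs <;> positivity
    · have hlow := mul_pow_le_elemSymm (a := (p - 1) * N ^ (p - 1) * (G' (u x) * r ^ m + m / r))
        (b := N ^ (p - 1) / r) hk hkn (⟨0, by omega⟩ : Fin n) (by positivity) (by positivity)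
      rw [radial_eigenvalue_mul_pow_eq hk hs hr hq hN rfl, hmq] at hlow
      -- The choice of `m` makes the remaining power of `r` exactly the weight `|x|^{αk}`.
      have hα : r ^ ((k : ℝ) * (α + 1)) / r ^ k = (r ^ α) ^ k := by
        rw [← Real.rpow_natCast, ← Real.rpow_natCast, ← Real.rpow_mul hr.le, ← Real.rpow_sub hr]
        congr 1
        ring
      rw [mul_div_assoc, hα] at hlow
      have hfx := hineq r hr
      have hux : Φ (r ^ (1 + m) / (1 + m)) = u x := by simp [hu, radialFun, hrdef]
      rw [hux] at hfx
      rw [ENNReal.ofReal_rpow_of_pos hr, ENNReal.ofReal_rpow_of_pos hN0,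
        ← ENNReal.ofReal_mul (by positivity), ← ENNReal.ofReal_mul (by positivity)]
      refine ENNReal.ofReal_le_ofReal ?_
      have hf0 := hf_pos (u x)
      have hX : 0 ≤ r ^ α * N ^ β * f (u x) := by positivity
      rw [← Real.pow_rpow_inv_natCast hX (by omega : k ≠ 0), one_div]
      refine Real.rpow_le_rpow (by positivity) (le_trans ?_ hlow) (by positivity)
      rw [mul_pow, mul_pow]
      calc (r ^ α) ^ k * (N ^ β) ^ k * f (u x) ^ k ≤ (r ^ α) ^ k * (N ^ β) ^ k *
            ((p - 1) * (G (u x) ^ q * (G' (u x) * r ^ (m + 1) + m))) := by gcongr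
        _ = _ := by ring

/-- The inequality of `isEntireSubsolution_radialFun` is met by its term `m` where `u ≤ 0`, and by
its term `G' r^{m+1}` where `u ≥ 0`, provided that `u ≥ 0` occurs only for `r ≥ 1`. -/
theorem exists_profile_of_kellerOsserman (hk : 1 ≤ k) (hkn : k ≤ n) (hp : 1 < p)
    (hα : -1 < α) (hβ : β < p - 1) (hf_cont : Continuous f) (hf_mono : Monotone f)
    (hf_pos : ∀ t, 0 < f t) {κ : ℝ} (hκ : 1 ≤ κ)
    (hKO : KellerOsserman (fun s => f s ^ (κ * k)) (κ * k * (p - β - 1)))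
    (hmdef : m = (α + 1) / (p - β - 1)) :
    ∃ Φ G G' : ℝ → ℝ, (∀ s, HasDerivAt G (G' s) s) ∧ Continuous G' ∧
      (∀ t, HasDerivAt Φ (G (Φ t)) t) ∧
      IsEntireSubsolution k p α β f (radialFun Φ m (0 : EuclideanSpace ℝ (Fin n))) := by
  have hk0 : (0 : ℝ) < k := by exact_mod_cast hk
  have hpβ : 0 < p - β - 1 := by linarith
  have hp1 : 0 < p - 1 := by linarith
  set q : ℝ := k * (p - β - 1) with hq
  have hq0 : 0 < q := by positivity
  have hm : 0 < m := by rw [hmdef]; exact div_pos (by linarith) hpβ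
  have hmq : m * q = k * (α + 1) := by rw [hmdef, hq]; field_simp
  have hfk_cont : Continuous fun s => f s ^ k := hf_cont.pow k
  have hfk_mono : Monotone fun s => f s ^ k := fun s t hst =>
    pow_le_pow_left₀ (hf_pos s).le (hf_mono hst) k
  have hfk_pos : ∀ t, 0 < f t ^ k := fun t => pow_pos (hf_pos t) k
  -- This normalization gives `(p-1) G^q G' = f^k` wherever the cutoff in `g` equals one.
  set C : ℝ := (q + 1) / (p - 1) with hC
  have hC0 : 0 < C := by positivity
  set g : ℝ → ℝ := fun s => C * (f s ^ k * max 0 (min 1 (s + 1))) with hg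
  have hg_cont : Continuous g := by fun_prop
  have hg0 : ∀ s, 0 ≤ g s := fun s =>
    mul_nonneg hC0.le (mul_nonneg (hfk_pos s).le (le_max_left _ _))
  have hga : ∀ s ≤ (-1 : ℝ), g s = 0 := by
    intro s hs
    have : max 0 (min 1 (s + 1)) = 0 := max_eq_left ((min_le_right _ _).trans (by linarith))
    simp [hg, this]
  have hg1 : ∀ s, 0 ≤ s → g s = C * f s ^ k := by
    intro s hs
    have : max 0 (min 1 (s + 1)) = 1 := by rw [min_eq_left (by linarith)]; simp
    simp [hg, this]
  have hgle : ∀ s, g s ≤ C * f s ^ k := by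
    intro s
    refine mul_le_mul_of_nonneg_left (mul_le_of_le_one_right (hfk_pos s).le ?_) hC0.le
    exact max_le zero_le_one (min_le_left _ _)
  -- Chosen so that `(p-1) m A^{q/(q+1)} = f(0)^k`, which settles the region `u ≤ 0`.
  set A : ℝ := (f 0 ^ k / ((p - 1) * m)) ^ ((q + 1) / q) with hA
  have hA0 : 0 < A := by have := hfk_pos 0; positivity
  have hApow : A ^ (q / (q + 1)) = f 0 ^ k / ((p - 1) * m) := by
    have := hfk_pos 0
    rw [hA, ← Real.rpow_mul (by positivity), div_mul_div_comm, mul_comm q, div_self (by positivity),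
      Real.rpow_one]
  set G := speed q A 1 g (-1) with hGdef
  set G' := speedDeriv q A 1 g (-1) with hG'def
  have hGd : ∀ s, HasDerivAt G (G' s) s := hasDerivAt_speed hg_cont hg0 hga hA0
  have hG'c : Continuous G' := continuous_speedDeriv hg_cont hg0 hga hA0
  have hGc : Continuous G := continuous_speed hg_cont hg0 hga hA0
  have hGpos : ∀ s, 0 < G s := speed_pos hg0 hga hA0 one_pos
  have hG'0 : ∀ s, 0 ≤ G' s := speedDeriv_nonneg hg0 hga hA0 one_pos hq0
  have hGle : ∀ s, s ≤ -1 → G s = A ^ (1 / (q + 1)) := fun s hs => by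
    rw [hGdef, speed_of_le hga hs, one_mul]
  set e : ℝ := A ^ (1 / (q + 1)) with he
  have he0 : 0 < e := by positivity
  have hKO' : KellerOsserman (fun s => (f s ^ k) ^ κ) (κ * q) := by
    have h1 : (fun s => (f s ^ k) ^ κ) = fun s => f s ^ (κ * k) := by
      ext s
      rw [← Real.rpow_natCast, ← Real.rpow_mul (hf_pos s).le, mul_comm]
    rw [h1, hq, ← mul_assoc]
    exact hKO
  -- For `t > 1` the base of `G` is at most `(A/f(0)^k + 2C) t f(t)^k`, since `t + 1 ≤ 2t`. The
  -- profile starts at `-1 - e` and has the constant speed `e` up to `-1`, so `Φ 1 = -1`.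
  have htop := tendsto_integral_inv_atTop_of_not_integrableOn (K := (A / f 0 ^ k + 2 * C) ^
      (1 / (q + 1))) hGc hGpos (-1 - e) (h := fun t => (t * f t ^ k) ^ (-(1 / (q + 1))))
    (fun t ht => by
      have := hfk_pos t
      have : (0 : ℝ) < t := one_pos.trans ht
      positivity)
    (fun t ht => by
      have ht1 : (1 : ℝ) < t := ht
      have hft := hfk_pos t
      have hf0 := hfk_pos 0
      have h2 := integral_nonneg_of_eq_zero_Iic hg0 hga t
      have h3 := intervalIntegral.integral_mono_on (μ := volume) (by linarith : (-1 : ℝ) ≤ t)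
        (hg_cont.intervalIntegrable (-1) t) (g := fun _ => C * f t ^ k) intervalIntegrable_const
        (fun s hs => (hgle s).trans (mul_le_mul_of_nonneg_left (hfk_mono hs.2) hC0.le))
      rw [intervalIntegral.integral_const, smul_eq_mul] at h3
      have h4 : A ≤ A / f 0 ^ k * (t * f t ^ k) := by
        have h5 : f 0 ^ k ≤ t * f t ^ k := by
          have := hfk_mono (by linarith : (0 : ℝ) ≤ t)
          dsimp only at this
          nlinarith
        calc A = A / f 0 ^ k * f 0 ^ k := by field_simp
          _ ≤ _ := by gcongr
      have h6 : A + ∫ r in (-1)..t, g r ≤ (A / f 0 ^ k + 2 * C) * (t * f t ^ k) := by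
        have : (t - -1) * (C * f t ^ k) ≤ 2 * C * (t * f t ^ k) := by
          have : 0 < C * f t ^ k := by positivity
          nlinarith
        linarith
      have ht0 : 0 < t := by linarith
      have h7 : G t ≤ (A / f 0 ^ k + 2 * C) ^ (1 / (q + 1)) * (t * f t ^ k) ^ (1 / (q + 1)) := by
        rw [hGdef, speed, one_mul, ← Real.mul_rpow (by positivity) (by positivity)]
        exact Real.rpow_le_rpow (by positivity) h6 (by positivity)
      rw [Real.rpow_neg (by positivity), ← div_eq_mul_inv, le_div_iff₀ (hGpos t),
        inv_mul_le_iff₀ (by positivity), mul_comm]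
      exact h7)
    (by
      refine (ContinuousOn.rpow_const (continuous_id.mul hfk_cont).continuousOn
        fun t ht => Or.inl ?_).aestronglyMeasurable measurableSet_Ioi
      have : (0 : ℝ) < t := one_pos.trans ht
      exact (mul_pos this (hfk_pos t)).ne')
    (not_integrableOn_of_kellerOsserman hfk_cont hfk_mono hfk_pos hq0 hκ hKO')
  have hbot := tendsto_integral_inv_atBot_of_le hGc hGpos (a := -1 - e) (M := e)
    (fun s hs => (hGle s (by linarith)).le)
  obtain ⟨Φ, hΦ, hΦmono, hΦτ⟩ := exists_hasDerivAt_comp_self hGc hGpos (-1 - e) hbot htop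
  have hΦ1 : Φ 1 = -1 := by
    have : ∫ r in (-1 - e)..(-1), (G r)⁻¹ = 1 := by
      rw [intervalIntegral.integral_congr (g := fun _ => e⁻¹)]
      · rw [intervalIntegral.integral_const, smul_eq_mul]
        field_simp
        ring
      · intro r hr
        rw [Set.uIcc_of_le (by linarith)] at hr
        simp only [hGle r hr.2]
    have h1 := hΦτ (-1)
    rwa [this] at h1
  refine ⟨Φ, G, G', hGd, hG'c, hΦ, isEntireSubsolution_radialFun hk hkn hp hm hq hmq hf_pos hGd
    hG'c hGpos hG'0 hΦ fun r hr => ?_⟩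
  set s := Φ (r ^ (1 + m) / (1 + m)) with hs
  have hGq : A ^ (q / (q + 1)) ≤ G s ^ q := by
    have h2 := integral_nonneg_of_eq_zero_Iic hg0 hga s
    rw [hGdef, speed_rpow hg0 hga hA0 one_pos, Real.one_rpow, one_mul]
    exact Real.rpow_le_rpow hA0.le (by linarith) (by positivity)
  have hGqpos : 0 < G s ^ q := Real.rpow_pos_of_pos (hGpos s) q
  rcases le_total s 0 with h | h
  · calc f s ^ k ≤ f 0 ^ k := hfk_mono h
      _ = (p - 1) * (A ^ (q / (q + 1)) * m) := by rw [hApow]; field_simp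
      _ ≤ (p - 1) * (G s ^ q * (G' s * r ^ (m + 1) + m)) := by
        have : 0 ≤ G' s * r ^ (m + 1) := mul_nonneg (hG'0 s) (by positivity)
        gcongr
        linarith
  -- For `r < 1` the argument of `Φ` is below `1`, so `Φ` would be below `Φ 1 = -1`.
  · have hr1 : 1 ≤ r := by
      by_contra hr1
      push Not at hr1
      have h1 : r ^ (1 + m) / (1 + m) < 1 := by
        rw [div_lt_one (by linarith)]
        have := Real.rpow_le_one hr.le hr1.le (by linarith : 0 ≤ 1 + m)
        linarith
      have h2 := hΦmono h1
      rw [hΦ1, ← hs] at h2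
      linarith
    have h1 : G s ^ q * G' s = 1 / (p - 1) * f s ^ k := by
      rw [hGdef, hG'def, speed_rpow_mul_speedDeriv hg0 hga hA0 one_pos hq0, hg1 s h, hC,
        Real.one_rpow]
      field_simp
    have h2 : 1 ≤ r ^ (m + 1) := Real.one_le_rpow hr1 (by linarith)
    calc f s ^ k = (p - 1) * (G s ^ q * G' s) := by rw [h1]; field_simp
      _ ≤ (p - 1) * (G s ^ q * (G' s * r ^ (m + 1) + m)) := by
        gcongr
        nlinarith [hG'0 s]

end Subsolution

/-! ### Powers of the norm at the origin. -/

section NormPower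

variable {E : Type*} [NormedAddCommGroup E] [InnerProductSpace ℝ E]

/-- Only the origin matters: there the derivative is bounded by `(1+t)|x|^t`, which tends to zero
for `t > 0`. -/
theorem contDiff_one_norm_rpow_smul {t : ℝ} (ht : 0 ≤ t) :
    ContDiff ℝ 1 (fun x : E => ‖x‖ ^ t • x) := by
  rcases ht.eq_or_lt with rfl | ht
  · simpa using contDiff_fun_id
  set D : E → E →L[ℝ] E := fun x => ‖x‖ ^ t • ContinuousLinearMap.id ℝ E +
    (t * ‖x‖ ^ (t - 1) / ‖x‖) • (innerSL ℝ x).smulRight x with hD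
  have hpow : Filter.Tendsto (fun x : E => ‖x‖ ^ t) (nhds 0) (nhds 0) := by
    have h : Continuous fun x : E => ‖x‖ ^ t := continuous_norm.rpow_const fun x => Or.inr ht.le
    have := h.tendsto 0
    rwa [norm_zero, Real.zero_rpow ht.ne'] at this
  have hD0 : D 0 = 0 := by simp [hD, Real.zero_rpow ht.ne']
  have hder : ∀ x, HasFDerivAt (fun x : E => ‖x‖ ^ t • x) (D x) x := by
    intro x
    by_cases hx : x = 0
    · subst hx
      rw [hD0]
      refine .of_isLittleO ?_
      have h1 : (fun x : E => ‖x‖ ^ t • x) =o[nhds 0] fun x : E => (1 : ℝ) • x :=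
        ((Asymptotics.isLittleO_one_iff ℝ).2 hpow).smul_isBigO (Asymptotics.isBigO_refl _ _)
      simpa using h1
    · exact hasFDerivAt_radial_smul hx (χ := fun r => r ^ t)
        (Real.hasDerivAt_rpow_const (Or.inl (norm_ne_zero_iff.2 hx)))
  have hfd : fderiv ℝ (fun x : E => ‖x‖ ^ t • x) = D := funext fun x => (hder x).fderiv
  rw [contDiff_one_iff_fderiv]
  refine ⟨fun x => (hder x).differentiableAt, continuous_iff_continuousAt.2 fun x => ?_⟩
  by_cases hx : x = 0
  · subst hx
    rw [hfd, ContinuousAt, hD0, tendsto_zero_iff_norm_tendsto_zero]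
    have hbound : ∀ x : E, ‖D x‖ ≤ (1 + t) * ‖x‖ ^ t := by
      intro x
      by_cases hx : x = 0
      · subst hx; rw [hD0, norm_zero]; positivity
      have hr : 0 < ‖x‖ := norm_pos_iff.2 hx
      calc ‖D x‖ ≤ ‖x‖ ^ t * 1 + (t * ‖x‖ ^ (t - 1) / ‖x‖) * (‖x‖ * ‖x‖) := by
            refine (norm_add_le _ _).trans (add_le_add ?_ ?_)
            · rw [norm_smul, Real.norm_of_nonneg (by positivity)]
              exact mul_le_mul_of_nonneg_left ContinuousLinearMap.norm_id_le (by positivity)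
            · rw [norm_smul, Real.norm_of_nonneg (by positivity),
                ContinuousLinearMap.norm_smulRight_apply, innerSL_apply_norm]
        _ = (1 + t) * ‖x‖ ^ t := by
            rw [Real.rpow_sub_one hr.ne']
            field_simp
    refine squeeze_zero (fun x => norm_nonneg _) hbound ?_
    simpa using hpow.const_mul (1 + t)
  · have h1 : ContDiffAt ℝ 1 (fun x : E => ‖x‖ ^ t • x) x :=
      ((contDiffAt_norm ℝ hx).rpow_const_of_ne (norm_ne_zero_iff.2 hx)).smul contDiffAt_id
    exact (h1.fderiv_right (m := 0) (by norm_num)).continuousAt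

theorem contDiff_two_norm_rpow {s : ℝ} (hs : 2 ≤ s) : ContDiff ℝ 2 (fun x : E => ‖x‖ ^ s) := by
  have hder : fderiv ℝ (fun x : E => ‖x‖ ^ s) =
      fun x => s • innerSL ℝ (‖x‖ ^ (s - 2) • x) := by
    ext1 x
    rw [fderiv_norm_rpow x (by linarith), map_smul, smul_smul]
  rw [show (2 : ℕ∞ω) = 1 + 1 by norm_num, contDiff_succ_iff_fderiv, hder]
  refine ⟨fun x => (hasFDerivAt_norm_rpow x (by linarith)).differentiableAt, by simp, ?_⟩
  have hL : ContDiff ℝ 1 (fun x : E => innerSL ℝ x) :=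
    (show E →L[ℝ] E →L[ℝ] ℝ from innerSL ℝ).contDiff
  exact (hL.comp (contDiff_one_norm_rpow_smul (E := E) (by linarith : 0 ≤ s - 2))).const_smul s

end NormPower

/-! ### Weak derivatives with a singularity at the origin. -/

section WeakDerivatives

open Filter Set
open scoped RealInnerProductSpace Gradient

variable {n : ℕ}

/-- The power `|x|^{-σδ}` is locally integrable because `σδ < 1 ≤ n`. -/
theorem memLpLoc_of_norm_le (hn : 1 ≤ n) {σ δ : ℝ} (hδ : 1 ≤ δ)
    (hσδ : σ * δ < 1) {F c : EuclideanSpace ℝ (Fin n) → ℝ} (hF : AEStronglyMeasurable F)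
    (hc : Continuous c) (h : ∀ x, |F x| ≤ c x * ‖x‖ ^ (-σ)) : MemLpLoc δ F := by
  intro K hK
  have hδ0 : 0 < δ := by linarith
  have hfr : Module.finrank ℝ (EuclideanSpace ℝ (Fin n)) = n := finrank_euclideanSpace_fin
  have hmeas : Measurable fun x : EuclideanSpace ℝ (Fin n) => ‖x‖ ^ (-σ) := by fun_prop
  have hbase : MemLp (fun x : EuclideanSpace ℝ (Fin n) => ‖x‖ ^ (-σ)) (ENNReal.ofReal δ)
      (volume.restrict K) := by
    rw [← integrable_norm_rpow_iff hmeas.aestronglyMeasurable (by simpa using hδ0)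
      ENNReal.ofReal_ne_top, ENNReal.toReal_ofReal hδ0.le]
    have hloc : LocallyIntegrable
        (fun x : EuclideanSpace ℝ (Fin n) => ‖‖x‖ ^ (-σ)‖ ^ δ) := by
      refine locallyIntegrable_of_norm_le_rpow (C := 1) (α := σ * δ) (by rw [hfr]; exact hn) ?_
        (Eventually.of_forall fun x => ?_) (by
          have : Measurable fun x : EuclideanSpace ℝ (Fin n) => ‖‖x‖ ^ (-σ)‖ ^ δ := by fun_prop
          exact this.aestronglyMeasurable)
      · rw [hfr]
        have : (1 : ℝ) ≤ n := by exact_mod_cast hn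
        linarith
      · rw [Real.norm_of_nonneg (by positivity), Real.norm_of_nonneg (by positivity),
          ← Real.rpow_mul (norm_nonneg x), one_mul]
        exact le_of_eq (by congr 1; ring)
    exact hloc.integrableOn_isCompact hK
  obtain ⟨M, hM⟩ := (hK.image hc).isBounded.bddAbove
  refine hbase.of_le_mul (c := M) hF.restrict ?_
  refine ae_restrict_of_forall_mem hK.measurableSet fun x hx => ?_
  rw [Real.norm_eq_abs, Real.norm_of_nonneg (by positivity)]
  exact (h x).trans (mul_le_mul_of_nonneg_right (hM (mem_image_of_mem c hx)) (by positivity))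

theorem memLpLoc_of_continuous {δ : ℝ} {F : EuclideanSpace ℝ (Fin n) → ℝ} (hF : Continuous F) :
    MemLpLoc δ F := by
  intro K hK
  obtain ⟨M, hM⟩ := (hK.image hF.norm).isBounded.bddAbove
  have : IsFiniteMeasure (volume.restrict K) := ⟨by
    rw [Measure.restrict_apply_univ]; exact hK.measure_lt_top⟩
  refine MemLp.of_bound hF.aestronglyMeasurable M ?_
  exact ae_restrict_of_forall_mem hK.measurableSet fun x hx => hM (mem_image_of_mem _ hx)

theorem locallyIntegrable_of_memLpLoc_one {F : EuclideanSpace ℝ (Fin n) → ℝ}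
    (h : MemLpLoc 1 F) : LocallyIntegrable F := by
  rw [locallyIntegrable_iff]
  intro K hK
  have := h K hK
  rwa [ENNReal.ofReal_one, memLp_one_iff_integrable] at this

theorem integral_mul_fderiv_eq_neg {F φ : EuclideanSpace ℝ (Fin n) → ℝ} (hF : ContDiff ℝ 1 F)
    (hφ : ContDiff ℝ ∞ φ) (hc : HasCompactSupport φ) (v : EuclideanSpace ℝ (Fin n)) :
    ∫ x, F x * fderiv ℝ φ x v = -∫ x, fderiv ℝ F x v * φ x := by
  have hφ' : Continuous fun x => fderiv ℝ φ x v :=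
    (hφ.continuous_fderiv (by simp)).clm_apply continuous_const
  have hF' : Continuous fun x => fderiv ℝ F x v :=
    (hF.continuous_fderiv one_ne_zero).clm_apply continuous_const
  refine integral_mul_fderiv_eq_neg_fderiv_mul_of_integrable ?_ ?_ ?_
    (fun x _ => hF.differentiable one_ne_zero x) (fun x _ => hφ.differentiable (by simp) x)
  · exact (hF'.mul hφ.continuous).integrable_of_hasCompactSupport hc.mul_left
  · exact (hF.continuous.mul hφ').integrable_of_hasCompactSupport
      ((hc.fderiv_apply ℝ v).mul_left)
  · exact (hF.continuous.mul hφ.continuous).integrable_of_hasCompactSupport hc.mul_left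

theorem hasWeakPartialDeriv_of_contDiff {F : EuclideanSpace ℝ (Fin n) → ℝ} (hF : ContDiff ℝ 1 F)
    (i : Fin n) :
    HasWeakPartialDeriv i F (fun x => fderiv ℝ F x (EuclideanSpace.single i 1)) :=
  ⟨hF.continuous.locallyIntegrable,
    ((hF.continuous_fderiv one_ne_zero).clm_apply continuous_const).locallyIntegrable,
    fun _ hφ hc => integral_mul_fderiv_eq_neg hF hφ hc _⟩

/-- The regularization `(|x|² + t)^{-σ/2} x_i` of `|x|^{-σ} x_i`. -/
noncomputable def regPow (σ : ℝ) (i : Fin n) (t : ℝ) (x : EuclideanSpace ℝ (Fin n)) : ℝ :=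
  (‖x‖ ^ 2 + t) ^ (-σ / 2) * x i

/-- The derivative of `regPow σ i t` in the direction `v`. -/
noncomputable def regPowDeriv (σ : ℝ) (i : Fin n) (v : EuclideanSpace ℝ (Fin n)) (t : ℝ)
    (x : EuclideanSpace ℝ (Fin n)) : ℝ :=
  (‖x‖ ^ 2 + t) ^ (-σ / 2 - 1) * (-σ * ⟪x, v⟫) * x i + (‖x‖ ^ 2 + t) ^ (-σ / 2) * v i

variable {σ t : ℝ} {i : Fin n}

theorem contDiff_regPow (ht : 0 < t) : ContDiff ℝ 1 (regPow σ i t) := by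
  have h1 : ContDiff ℝ 1 fun x : EuclideanSpace ℝ (Fin n) => ‖x‖ ^ 2 + t :=
    (contDiff_norm_sq ℝ).add contDiff_const
  refine (contDiff_iff_contDiffAt.2 fun x =>
    h1.contDiffAt.rpow_const_of_ne (by positivity)).mul ?_
  exact (EuclideanSpace.proj (𝕜 := ℝ) i).contDiff

theorem fderiv_regPow (ht : 0 < t) (x v : EuclideanSpace ℝ (Fin n)) :
    fderiv ℝ (regPow σ i t) x v = regPowDeriv σ i v t x := by
  have hpos : 0 < ‖x‖ ^ 2 + t := by positivity
  have h1 : HasFDerivAt (fun x : EuclideanSpace ℝ (Fin n) => ‖x‖ ^ 2 + t) (2 • innerSL ℝ x) x :=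
    ((hasStrictFDerivAt_norm_sq x).hasFDerivAt).add_const t
  have h2 := h1.rpow_const (p := -σ / 2) (Or.inl hpos.ne')
  have h3 : HasFDerivAt (fun x : EuclideanSpace ℝ (Fin n) => x i)
      (EuclideanSpace.proj (𝕜 := ℝ) i) x := (EuclideanSpace.proj (𝕜 := ℝ) i).hasFDerivAt
  have h4 : HasFDerivAt (regPow σ i t) _ x := h2.mul h3
  rw [h4.fderiv]
  simp [regPowDeriv]
  ring

theorem sq_rpow_neg_half (σ : ℝ) (x : EuclideanSpace ℝ (Fin n)) :
    (‖x‖ ^ 2) ^ (-σ / 2) = ‖x‖ ^ (-σ) := by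
  rw [← Real.rpow_natCast, ← Real.rpow_mul (norm_nonneg x)]
  congr 1
  push_cast
  ring

theorem add_rpow_le (hσ : 0 < σ) (ht : 0 ≤ t) {x : EuclideanSpace ℝ (Fin n)} (hx : x ≠ 0) :
    (‖x‖ ^ 2 + t) ^ (-σ / 2) ≤ ‖x‖ ^ (-σ) := by
  rw [← sq_rpow_neg_half]
  have : 0 < ‖x‖ := norm_pos_iff.2 hx
  exact Real.rpow_le_rpow_of_nonpos (by positivity) (by linarith) (by linarith)

theorem abs_coord_le (x : EuclideanSpace ℝ (Fin n)) (i : Fin n) : |x i| ≤ ‖x‖ :=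
  PiLp.norm_apply_le x i

theorem abs_regPow_le (hσ : 0 < σ) (ht : 0 ≤ t) {x : EuclideanSpace ℝ (Fin n)}
    (hx : x ≠ 0) : |regPow σ i t x| ≤ ‖x‖ * ‖x‖ ^ (-σ) := by
  rw [regPow, abs_mul, abs_of_nonneg (by positivity), mul_comm]
  exact mul_le_mul (abs_coord_le x i) (add_rpow_le hσ ht hx) (by positivity) (by positivity)

/-- The bound is uniform in `t`: it is the dominating function for the limit `t → 0`. -/
theorem abs_regPowDeriv_le (hσ : 0 < σ) (hσ1 : σ < 1) (ht : 0 ≤ t)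
    {x v : EuclideanSpace ℝ (Fin n)} (hv : ‖v‖ ≤ 1) (hx : x ≠ 0) :
    |regPowDeriv σ i v t x| ≤ 2 * ‖x‖ ^ (-σ) := by
  have hr : 0 < ‖x‖ := norm_pos_iff.2 hx
  have hpos : 0 < ‖x‖ ^ 2 + t := by positivity
  have h0 := add_rpow_le hσ ht hx
  have h1 : |(‖x‖ ^ 2 + t) ^ (-σ / 2 - 1) * (-σ * ⟪x, v⟫) * x i| ≤ ‖x‖ ^ (-σ) := by
    rw [abs_mul, abs_mul, abs_mul, abs_of_nonneg (by positivity), abs_neg, abs_of_pos hσ]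
    have h2 : |⟪x, v⟫| ≤ ‖x‖ := (abs_real_inner_le_norm x v).trans
      (mul_le_of_le_one_right hr.le hv)
    calc (‖x‖ ^ 2 + t) ^ (-σ / 2 - 1) * (σ * |⟪x, v⟫|) * |x i|
        ≤ (‖x‖ ^ 2 + t) ^ (-σ / 2 - 1) * (1 * ‖x‖) * ‖x‖ := by
          gcongr
          exact abs_coord_le x i
      _ = (‖x‖ ^ 2 + t) ^ (-σ / 2) * (‖x‖ ^ 2 / (‖x‖ ^ 2 + t)) := by
          rw [Real.rpow_sub_one hpos.ne']
          field_simp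
      _ ≤ (‖x‖ ^ 2 + t) ^ (-σ / 2) * 1 := by
          gcongr
          rw [div_le_one hpos]
          linarith
      _ ≤ _ := by linarith
  have h2 : |(‖x‖ ^ 2 + t) ^ (-σ / 2) * v i| ≤ ‖x‖ ^ (-σ) := by
    rw [abs_mul, abs_of_nonneg (by positivity)]
    exact (mul_le_of_le_one_right (by positivity) ((abs_coord_le v i).trans hv)).trans h0
  unfold regPowDeriv
  linarith [abs_add_le ((‖x‖ ^ 2 + t) ^ (-σ / 2 - 1) * (-σ * ⟪x, v⟫) * x i)
    ((‖x‖ ^ 2 + t) ^ (-σ / 2) * v i)]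

theorem regPow_zero_zero : regPow σ i 0 0 = 0 := by
  simp [regPow]

/-- A nonzero real power of `0` is `0` by convention, so the bounds by `|x|^{-σ}` also hold at the
origin, as `0 ≤ 0`. -/
theorem regPowDeriv_zero_zero (hσ : 0 < σ) (v : EuclideanSpace ℝ (Fin n)) :
    regPowDeriv σ i v 0 0 = 0 := by
  simp [regPowDeriv, Real.zero_rpow (by linarith : -σ / 2 ≠ 0)]

theorem measurable_regPow : Measurable (regPow σ i t) := by
  unfold regPow
  fun_prop

theorem measurable_regPowDeriv (v : EuclideanSpace ℝ (Fin n)) :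
    Measurable (regPowDeriv σ i v t) := by
  unfold regPowDeriv
  fun_prop

/-- The weak derivative of `a(x) |x|^{-σ} x_i`. -/
theorem hasWeakPartialDeriv_mul_regPow (hn : 1 ≤ n) (hσ : 0 < σ) (hσ1 : σ < 1)
    {a : EuclideanSpace ℝ (Fin n) → ℝ} (ha : ContDiff ℝ 1 a) (i j : Fin n) :
    HasWeakPartialDeriv j (fun x => a x * regPow σ i 0 x)
      (fun x => fderiv ℝ a x (EuclideanSpace.single j 1) * regPow σ i 0 x +
        a x * regPowDeriv σ i (EuclideanSpace.single j 1) 0 x) ∧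
    ∀ δ, 1 ≤ δ → σ * δ < 1 →
      MemLpLoc δ (fun x => fderiv ℝ a x (EuclideanSpace.single j 1) * regPow σ i 0 x +
        a x * regPowDeriv σ i (EuclideanSpace.single j 1) 0 x) := by
  set v : EuclideanSpace ℝ (Fin n) := EuclideanSpace.single j 1 with hv
  have hv1 : ‖v‖ ≤ 1 := by simp [hv]
  have hac := ha.continuous
  have ha' : Continuous fun x => fderiv ℝ a x v :=
    (ha.continuous_fderiv one_ne_zero).clm_apply continuous_const
  set c₁ : EuclideanSpace ℝ (Fin n) → ℝ := fun x => |a x| * ‖x‖ with hc₁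
  set c₂ : EuclideanSpace ℝ (Fin n) → ℝ := fun x => |fderiv ℝ a x v| * ‖x‖ + |a x| * 2 with hc₂
  have hc₁c : Continuous c₁ := by fun_prop
  have hc₂c : Continuous c₂ := by fun_prop
  have hb₁ : ∀ t, 0 ≤ t → ∀ x ≠ 0, |a x * regPow σ i t x| ≤ c₁ x * ‖x‖ ^ (-σ) := by
    intro t ht x hx
    rw [abs_mul, hc₁, mul_assoc]
    exact mul_le_mul_of_nonneg_left (abs_regPow_le hσ ht hx) (abs_nonneg _)
  have hb₂ : ∀ t, 0 ≤ t → ∀ x ≠ 0, |fderiv ℝ a x v * regPow σ i t x +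
      a x * regPowDeriv σ i v t x| ≤ c₂ x * ‖x‖ ^ (-σ) := by
    intro t ht x hx
    refine (abs_add_le _ _).trans ?_
    rw [abs_mul, abs_mul, hc₂, add_mul, mul_assoc, mul_assoc]
    exact add_le_add
      (mul_le_mul_of_nonneg_left (abs_regPow_le hσ ht hx) (abs_nonneg _))
      (mul_le_mul_of_nonneg_left (abs_regPowDeriv_le hσ hσ1 ht hv1 hx) (abs_nonneg _))
  have hm₁ : ∀ t, Measurable fun x => a x * regPow σ i t x := fun t =>
    hac.measurable.mul measurable_regPow
  have hm₂ : ∀ t, Measurable fun x => fderiv ℝ a x v * regPow σ i t x +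
      a x * regPowDeriv σ i v t x := fun t =>
    (ha'.measurable.mul measurable_regPow).add (hac.measurable.mul (measurable_regPowDeriv v))
  have hL₁ : MemLpLoc 1 (fun x => a x * regPow σ i 0 x) := by
    refine memLpLoc_of_norm_le hn (σ := σ) le_rfl (by linarith) (hm₁ 0).aestronglyMeasurable hc₁c
      fun x => ?_
    by_cases hx : x = 0
    · subst hx; simp [regPow_zero_zero, hc₁]
    · exact hb₁ 0 le_rfl x hx
  have hL₂ : ∀ δ, 1 ≤ δ → σ * δ < 1 → MemLpLoc δ (fun x => fderiv ℝ a x v * regPow σ i 0 x +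
      a x * regPowDeriv σ i v 0 x) := by
    intro δ hδ hσδ
    refine memLpLoc_of_norm_le hn hδ hσδ (hm₂ 0).aestronglyMeasurable hc₂c fun x => ?_
    by_cases hx : x = 0
    · subst hx
      rw [regPow_zero_zero, regPowDeriv_zero_zero hσ]
      simp [Real.zero_rpow (by linarith : -σ ≠ 0)]
    · exact hb₂ 0 le_rfl x hx
  refine ⟨⟨locallyIntegrable_of_memLpLoc_one hL₁,
    locallyIntegrable_of_memLpLoc_one (hL₂ 1 le_rfl (by linarith)), ?_⟩, hL₂⟩
  intro φ hφ hcs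
  have : Nonempty (Fin n) := ⟨i⟩
  have hae : ∀ᵐ x : EuclideanSpace ℝ (Fin n), x ≠ 0 := by
    rw [ae_iff]
    simp
  have hφ' : Continuous fun x => fderiv ℝ φ x v :=
    (hφ.continuous_fderiv (by simp)).clm_apply continuous_const
  have hpowloc : LocallyIntegrable fun x : EuclideanSpace ℝ (Fin n) => ‖x‖ ^ (-σ) := by
    have hmeas : Measurable fun x : EuclideanSpace ℝ (Fin n) => ‖x‖ ^ (-σ) := by fun_prop
    refine locallyIntegrable_of_memLpLoc_one (memLpLoc_of_norm_le hn (σ := σ) le_rfl (by linarith)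
      (c := fun _ => 1) hmeas.aestronglyMeasurable continuous_const fun x => ?_)
    rw [abs_of_nonneg (by positivity), one_mul]
  have hint : ∀ c ψ : EuclideanSpace ℝ (Fin n) → ℝ, Continuous c → Continuous ψ →
      HasCompactSupport ψ → Integrable fun x => c x * ‖x‖ ^ (-σ) * ‖ψ x‖ := by
    intro c ψ hc hψ hs
    have := hpowloc.integrable_smul_left_of_hasCompactSupport
      (g := fun x => c x * ‖ψ x‖) (hc.mul hψ.norm) hs.norm.mul_left
    refine this.congr (Eventually.of_forall fun x => ?_)
    simp only [smul_eq_mul]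
    ring
  -- Integration by parts is classical for the regularized functions; both sides pass to the limit
  -- by dominated convergence.
  set ε : ℕ → ℝ := fun l => 1 / ((l : ℝ) + 1) with hε
  have hε0 : ∀ l, 0 < ε l := fun l => by positivity
  have hεt : Tendsto ε atTop (nhds 0) := tendsto_one_div_add_atTop_nhds_zero_nat
  have hlim : ∀ x : EuclideanSpace ℝ (Fin n), x ≠ 0 → ∀ b : ℝ, Tendsto (fun l => (‖x‖ ^ 2 + ε l) ^ b) atTop
      (nhds ((‖x‖ ^ 2 + 0) ^ b)) := by
    intro x hx b
    refine (tendsto_const_nhds.add hεt).rpow_const (Or.inl ?_)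
    have : 0 < ‖x‖ := norm_pos_iff.2 hx
    positivity
  have hlimP : ∀ x : EuclideanSpace ℝ (Fin n), x ≠ 0 →
      Tendsto (fun l => regPow σ i (ε l) x) atTop (nhds (regPow σ i 0 x)) := fun x hx =>
    (hlim x hx _).mul_const _
  have hlimD : ∀ x : EuclideanSpace ℝ (Fin n), x ≠ 0 →
      Tendsto (fun l => regPowDeriv σ i v (ε l) x) atTop (nhds (regPowDeriv σ i v 0 x)) :=
    fun x hx => (((hlim x hx _).mul_const _).mul_const _).add ((hlim x hx _).mul_const _)
  have hlhs : Tendsto (fun l => ∫ x, a x * regPow σ i (ε l) x * fderiv ℝ φ x v) atTop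
      (nhds (∫ x, a x * regPow σ i 0 x * fderiv ℝ φ x v)) := by
    refine tendsto_integral_of_dominated_convergence
      (fun x => c₁ x * ‖x‖ ^ (-σ) * ‖fderiv ℝ φ x v‖)
      (fun l => ((hm₁ (ε l)).mul hφ'.measurable).aestronglyMeasurable)
      (hint _ _ hc₁c hφ' (hcs.fderiv_apply ℝ v)) (fun l => ?_) ?_
    · filter_upwards [hae] with x hx
      rw [norm_mul]
      exact mul_le_mul_of_nonneg_right (hb₁ _ (hε0 l).le x hx) (norm_nonneg _)
    · filter_upwards [hae] with x hx
      exact ((hlimP x hx).const_mul _).mul_const _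
  have hrhs : Tendsto (fun l => ∫ x, (fderiv ℝ a x v * regPow σ i (ε l) x +
        a x * regPowDeriv σ i v (ε l) x) * φ x) atTop
      (nhds (∫ x, (fderiv ℝ a x v * regPow σ i 0 x + a x * regPowDeriv σ i v 0 x) * φ x)) := by
    refine tendsto_integral_of_dominated_convergence
      (fun x => c₂ x * ‖x‖ ^ (-σ) * ‖φ x‖)
      (fun l => ((hm₂ (ε l)).mul hφ.continuous.measurable).aestronglyMeasurable)
      (hint _ _ hc₂c hφ.continuous hcs) (fun l => ?_) ?_
    · filter_upwards [hae] with x hx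
      rw [norm_mul]
      exact mul_le_mul_of_nonneg_right (hb₂ _ (hε0 l).le x hx) (norm_nonneg _)
    · filter_upwards [hae] with x hx
      exact (((hlimP x hx).const_mul _).add ((hlimD x hx).const_mul _)).mul_const _
  refine tendsto_nhds_unique hlhs (hrhs.neg.congr fun l => ?_)
  have hcd : ContDiff ℝ 1 fun x => a x * regPow σ i (ε l) x := ha.mul (contDiff_regPow (hε0 l))
  rw [integral_mul_fderiv_eq_neg hcd hφ hcs v]
  congr 2
  ext x
  rw [fderiv_fun_mul (ha.differentiable one_ne_zero x)
    ((contDiff_regPow (hε0 l)).differentiable one_ne_zero x)]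
  simp only [_root_.add_apply, _root_.smul_apply, smul_eq_mul, fderiv_regPow (hε0 l)]
  ring

end WeakDerivatives

/-! ### Regularity of the radial subsolution. -/

section Regularity

open scoped RealInnerProductSpace Gradient

variable {n : ℕ} {m : ℝ} {Φ G G' : ℝ → ℝ}

theorem contDiff_two_radialFun (hm : 1 ≤ m) (hG : ∀ s, HasDerivAt G (G' s) s) (hG' : Continuous G')
    (hΦ : ∀ t, HasDerivAt Φ (G (Φ t)) t) (y : EuclideanSpace ℝ (Fin n)) :
    ContDiff ℝ 2 (radialFun Φ m y) :=
  contDiff_radialFun (contDiff_two_of_hasDerivAt_comp hG hG' hΦ)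
    (contDiff_two_norm_rpow (by linarith))

/-- The gradient is `G(u) |x|^{m-1} x`, so the second derivatives are `O(|x|^{-(1-m)})` near the
origin, and `(1-m)δ < 1` is what their integrability needs. -/
theorem memW2Loc_radialFun (hn : 1 ≤ n) (hm : 0 < m) (hm1 : m < 1)
    (hG : ∀ s, HasDerivAt G (G' s) s) (hG' : Continuous G')
    (hΦ : ∀ t, HasDerivAt Φ (G (Φ t)) t) {δ : ℝ} (hδ : 1 ≤ δ) (hmδ : (1 - m) * δ < 1) :
    MemW2Loc δ (radialFun Φ m (0 : EuclideanSpace ℝ (Fin n))) := by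
  set u := radialFun Φ m (0 : EuclideanSpace ℝ (Fin n)) with hu
  have hΦ2 := contDiff_two_of_hasDerivAt_comp hG hG' hΦ
  have hu1 : ContDiff ℝ 1 u :=
    contDiff_radialFun (hΦ2.of_le (by norm_num)) (contDiff_norm_rpow (by linarith))
  have hGc : ContDiff ℝ 1 G := contDiff_one_iff_deriv.2
    ⟨fun s => (hG s).differentiableAt, by rwa [show deriv G = G' from funext fun s => (hG s).deriv]⟩
  have ha : ContDiff ℝ 1 fun x => G (u x) := hGc.comp hu1
  have hgi : ∀ i : Fin n, (fun x => fderiv ℝ u x (EuclideanSpace.single i 1)) =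
      fun x => G (u x) * regPow (1 - m) i 0 x := by
    intro i
    ext x
    rw [← inner_gradient_left, gradient_radialFun hm hΦ, sub_zero, ← hu, regPow, add_zero,
      sq_rpow_neg_half, neg_sub, inner_smul_left, EuclideanSpace.inner_single_right]
    simp
    ring
  refine ⟨memLpLoc_of_continuous hu1.continuous,
    fun i x => G (u x) * regPow (1 - m) i 0 x, fun i j x =>
      fderiv ℝ (fun x => G (u x)) x (EuclideanSpace.single j 1) * regPow (1 - m) i 0 x +
        G (u x) * regPowDeriv (1 - m) i (EuclideanSpace.single j 1) 0 x, fun i => ?_, fun i j => ?_⟩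
  · rw [show (fun (i : Fin n) x => G (u x) * regPow (1 - m) i 0 x) i = _ from (hgi i).symm]
    exact ⟨hasWeakPartialDeriv_of_contDiff hu1 i, memLpLoc_of_continuous
      ((hu1.continuous_fderiv one_ne_zero).clm_apply continuous_const)⟩
  · obtain ⟨h1, h2⟩ := hasWeakPartialDeriv_mul_regPow hn (by linarith : 0 < 1 - m)
      (by linarith) ha i j
    exact ⟨h1, h2 δ hδ hmδ⟩

end Regularity

/-! ### Maximum principle and comparison with a radial barrier. -/

section MaximumPrinciple

open Filter Metric Matrix
open scoped RealInnerProductSpace Gradient Topology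

variable {n k : ℕ} {p α β : ℝ} {f : ℝ → ℝ} {u : EuclideanSpace ℝ (Fin n) → ℝ}

theorem isEigenvalueVector_zero : IsEigenvalueVector (0 : Matrix (Fin n) (Fin n) ℝ) 0 := by
  have := isEigenvalueVector_diagonal (0 : Fin n → ℝ)
  rwa [show diagonal (0 : Fin n → ℝ) = 0 from diagonal_zero] at this

theorem elemSymm_one_zero : elemSymm 1 (0 : Fin n → ℝ) = 0 := by
  refine Finset.sum_eq_zero fun s hs => ?_
  simp [(Finset.mem_powersetCard.1 hs).2]

theorem pHessian_eq_zero_of_eventuallyEq {x c : EuclideanSpace ℝ (Fin n)}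
    (h : pGradient p u =ᶠ[𝓝 x] fun _ => c) : pHessian p u x = 0 := by
  ext i j
  simp [pHessian, h.fderiv_eq]

theorem exists_isMaxOn_interior {w : EuclideanSpace ℝ (Fin n) → ℝ} (hw : Continuous w)
    {y : EuclideanSpace ℝ (Fin n)} {ρ : ℝ} (hρ : 0 < ρ)
    (hb : ∀ x, ‖x - y‖ = ρ → w x < w y) :
    ∃ x, ‖x - y‖ < ρ ∧ w y ≤ w x ∧ IsLocalMax w x := by
  obtain ⟨x, hx, hmax⟩ := (isCompact_closedBall y ρ).exists_isMaxOn
    ⟨y, mem_closedBall_self hρ.le⟩ hw.continuousOn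
  have hxy : w y ≤ w x := hmax (mem_closedBall_self hρ.le)
  have hlt : ‖x - y‖ < ρ := by
    rw [mem_closedBall, dist_eq_norm] at hx
    refine lt_of_le_of_ne hx fun h => ?_
    exact absurd (hb x h) (not_lt.2 hxy)
  refine ⟨x, hlt, hxy, hmax.isLocalMax (mem_of_superset (isOpen_ball.mem_nhds ?_)
    ball_subset_closedBall)⟩
  rwa [mem_ball, dist_eq_norm]

theorem IsEntireSubsolution.contDiffAt_two (hu : IsEntireSubsolution k p α β f u)
    {x : EuclideanSpace ℝ (Fin n)} (hx : x ≠ 0) : ContDiffAt ℝ 2 u x :=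
  hu.contDiffOn_two.contDiffAt (isOpen_compl_singleton.mem_nhds hx)

/-- The maximum principle: the origin is no exceptional point. -/
theorem IsEntireSubsolution.le_of_forall_norm_eq (hu : IsEntireSubsolution k p α β f u)
    (hk : 1 ≤ k) (hkn : k ≤ n) (hp : 1 < p) {ρ M : ℝ} (hρ : 0 < ρ)
    (hM : ∀ x : EuclideanSpace ℝ (Fin n), ‖x‖ = ρ → u x ≤ M) : u 0 ≤ M := by
  by_contra hlt
  push Not at hlt
  set e : EuclideanSpace ℝ (Fin n) := EuclideanSpace.single ⟨0, by omega⟩ 1 with he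
  have he1 : ‖e‖ = 1 := by simp [he]
  have he0 : e ≠ 0 := by rw [← norm_ne_zero_iff, he1]; exact one_ne_zero
  -- A small tilt keeps the maximum off the sphere, and a slope different from `∇ u 0` keeps it off
  -- the origin, where nothing is known about second derivatives. Of two candidate slopes at least
  -- one is admissible.
  obtain ⟨ε, hε0, hερ, hεu⟩ : ∃ ε : ℝ, 0 < ε ∧ ε * ρ < u 0 - M ∧ ∇ u 0 ≠ -ε • e := by
    have hd : 0 < (u 0 - M) / ρ := div_pos (by linarith) hρ
    have hmul : (u 0 - M) / ρ * ρ = u 0 - M := div_mul_cancel₀ _ hρ.ne'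
    by_cases h : ∇ u 0 = -((u 0 - M) / ρ / 2) • e
    · refine ⟨(u 0 - M) / ρ / 4, by positivity, by nlinarith, fun h' => ?_⟩
      have h2 := smul_left_injective ℝ he0 (h.symm.trans h')
      linarith
    · exact ⟨(u 0 - M) / ρ / 2, by positivity, by nlinarith, h⟩
  set v : EuclideanSpace ℝ (Fin n) → ℝ := fun x => ⟪-ε • e, x⟫ with hv
  have hvc : ContDiff ℝ 2 v := contDiff_const.inner ℝ contDiff_id
  have hvg : ∀ x, ∇ v x = -ε • e := fun x => by
    refine HasGradientAt.gradient ?_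
    rw [hasGradientAt_iff_hasFDerivAt]
    exact (InnerProductSpace.toDual ℝ _ (-ε • e)).hasFDerivAt
  have huc : Continuous u := hu.contDiff_one.continuous
  obtain ⟨x, hx, hxy, hmax⟩ := exists_isMaxOn_interior (w := fun z => u z - v z) (y := 0)
    (huc.sub hvc.continuous) hρ (fun x hx => by
      rw [sub_zero] at hx
      have h1 := hM x hx
      have h2 := abs_le.1 (abs_real_inner_le_norm (-ε • e) x)
      rw [norm_smul, he1, norm_neg, Real.norm_of_nonneg hε0.le, hx] at h2
      have h3 : v 0 = 0 := by simp [hv]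
      have h4 : v x = ⟪-ε • e, x⟫ := rfl
      rw [h3]
      linarith [h2.1])
  have hgrad := gradient_eq_of_isLocalMax_sub (hu.contDiff_one.differentiable one_ne_zero x)
    (hvc.differentiable two_ne_zero x) hmax
  rw [hvg] at hgrad
  have hx0 : x ≠ 0 := by
    rintro rfl
    exact hεu hgrad
  obtain ⟨-, lam, hlam, hcone, -⟩ := hu.subsolution x hx0
  have hne : ∇ u x ≠ 0 := by
    rw [hgrad]
    exact smul_ne_zero (neg_ne_zero.2 hε0.ne') he0
  -- For the affine comparison function the matrix vanishes, so comparison of `S_1` gives `0 < S_1 ≤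
  -- 0`.
  have hmu : IsEigenvalueVector (pHessian p v x) 0 := by
    rw [pHessian_eq_zero_of_eventuallyEq (c := ‖-ε • e‖ ^ (p - 2) • (-ε • e))
      (Eventually.of_forall fun z => by simp only [pGradient, hvg])]
    exact isEigenvalueVector_zero
  have h1 := hcone 1 (Finset.mem_Icc.2 ⟨le_rfl, hk⟩)
  have h2 := elemSymm_le_of_isLocalMax (k := 1) hp (hu.contDiffAt_two hx0) hvc.contDiffAt hmax hne
    hlam hmu (fun j hj => hcone j (Finset.mem_Icc.2
      ⟨(Finset.mem_Icc.1 hj).1, (Finset.mem_Icc.1 hj).2.trans hk⟩))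
  rw [elemSymm_one_zero] at h2
  linarith

/-- If `Du` vanished near `x`, the matrix would be zero and `S_1 = 0`, outside the cone. Hence the
points with `Du ≠ 0` are dense. -/
theorem IsEntireSubsolution.frequently_gradient_ne_zero (hu : IsEntireSubsolution k p α β f u)
    (hk : 1 ≤ k) {x : EuclideanSpace ℝ (Fin n)} (hx : x ≠ 0) : ∃ᶠ z in 𝓝 x, ∇ u z ≠ 0 := by
  intro h
  obtain ⟨-, lam, hlam, hcone, -⟩ := hu.subsolution x hx
  have h0 : pHessian p u x = 0 := by
    refine pHessian_eq_zero_of_eventuallyEq (c := 0) ?_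
    filter_upwards [h] with z hz
    rw [not_ne_iff] at hz
    simp [pGradient, hz]
  rw [h0] at hlam
  have h1 := hcone 1 (Finset.mem_Icc.2 ⟨le_rfl, hk⟩)
  rw [hlam.elemSymm_eq, ← isEigenvalueVector_zero.elemSymm_eq, elemSymm_one_zero] at h1
  exact lt_irrefl _ h1

theorem IsAdmissibleSubsolutionAt.pow_le {x : EuclideanSpace ℝ (Fin n)} (hk : 1 ≤ k)
    (hx : x ≠ 0) (hg : ∇ u x ≠ 0) {S : ℝ} (hS : 0 ≤ S)
    (h : ENNReal.ofReal ‖x‖ ^ α * ENNReal.ofReal ‖gradient u x‖ ^ β * ENNReal.ofReal (f (u x)) ≤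
      ENNReal.ofReal (S ^ (1 / (k : ℝ)))) (hf : 0 < f (u x)) :
    (‖x‖ ^ α * ‖∇ u x‖ ^ β * f (u x)) ^ k ≤ S := by
  have hr : 0 < ‖x‖ := norm_pos_iff.2 hx
  have hN : 0 < ‖∇ u x‖ := norm_pos_iff.2 hg
  rw [ENNReal.ofReal_rpow_of_pos hr, ENNReal.ofReal_rpow_of_pos hN,
    ← ENNReal.ofReal_mul (by positivity), ← ENNReal.ofReal_mul (by positivity),
    ENNReal.ofReal_le_ofReal_iff (by positivity)] at h
  have := pow_le_pow_left₀ (by positivity) h k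
  rwa [one_div, Real.rpow_inv_natCast_pow hS (by omega)] at this

variable {m q v₀ : ℝ} {Φ G G' : ℝ → ℝ}

/-- The interior estimate by comparison with a radial barrier. -/
theorem IsEntireSubsolution.le_of_barrier (hu : IsEntireSubsolution k p α β f u)
    (hk : 1 ≤ k) (hkn : k ≤ n) (hp : 1 < p) (hα : α ≤ 0) (hm : 0 < m)
    (hq : q = k * (p - β - 1)) (hmq : m * q = k)
    (hf_mono : Monotone f) (hf_pos : ∀ t, 0 < f t)
    (hG : ∀ s, HasDerivAt G (G' s) s) (hG' : Continuous G') (hGpos : ∀ s, 0 < G s)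
    (hG'0 : ∀ s, 0 ≤ G' s) (hΦ : ∀ t, HasDerivAt Φ (G (Φ t)) t) {ρ R : ℝ} (hρ : 0 < ρ)
    (hΦ0 : Φ 0 = v₀) {y : EuclideanSpace ℝ (Fin n)} (hy : ρ < ‖y‖) (hyR : ‖y‖ + ρ ≤ R)
    (hgy : ∇ u y ≠ 0) (hbd : ∀ x, ‖x - y‖ = ρ → u x ≤ Φ (ρ ^ (1 + m) / (1 + m)))
    (hineq : ∀ r, 0 < r → r < ρ →
      2 ^ n * ((p - 1) * (G' (Φ (r ^ (1 + m) / (1 + m))) * r ^ (m + 1) + m) + 1) *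
        G (Φ (r ^ (1 + m) / (1 + m))) ^ q < (R ^ α * f (Φ (r ^ (1 + m) / (1 + m)))) ^ k) :
    u y ≤ v₀ := by
  by_contra hlt
  push Not at hlt
  set v := radialFun Φ m y with hv
  have hΦ2 := contDiff_two_of_hasDerivAt_comp hG hG' hΦ
  have hv1 : ContDiff ℝ 1 v :=
    contDiff_radialFun (hΦ2.of_le (by norm_num)) (contDiff_norm_rpow (by linarith))
  have hvy : v y = v₀ := by
    simp [hv, radialFun, Real.zero_rpow (by linarith : 1 + m ≠ 0), hΦ0]
  obtain ⟨x, hx, hxy, hmax⟩ := exists_isMaxOn_interior (w := fun z => u z - v z) (y := y)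
    (hu.contDiff_one.continuous.sub hv1.continuous) hρ (fun x hx => by
      have h1 := hbd x hx
      have h2 : v x = Φ (ρ ^ (1 + m) / (1 + m)) := by simp [hv, radialFun, hx]
      rw [hvy, h2]
      linarith)
  have hgrad := gradient_eq_of_isLocalMax_sub (hu.contDiff_one.differentiable one_ne_zero x)
    (hv1.differentiable one_ne_zero x) hmax
  -- The barrier has zero gradient at its centre, where comparison is not available; `∇ u y ≠ 0`
  -- rules out this point.
  have hne : x ≠ y := by
    rintro rfl
    refine hgy ?_
    rw [hgrad, gradient_radialFun hm hΦ]
    simp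
  have hx0 : x ≠ 0 := by
    rintro rfl
    rw [zero_sub, norm_neg] at hx
    linarith
  have hxR : ‖x‖ ≤ R := by
    have := norm_add_le (x - y) y
    rw [sub_add_cancel] at this
    linarith
  have hx0' : 0 < ‖x‖ := norm_pos_iff.2 hx0
  have hr : 0 < ‖x - y‖ := norm_pos_iff.2 (sub_ne_zero.2 hne)
  have hN := norm_gradient_radialFun hm hGpos hΦ x hne
  rw [← hv, ← hgrad] at hN
  have hs := hGpos (v x)
  have hc := hG'0 (v x)
  have hN0 : 0 < ‖∇ u x‖ := by rw [hN]; positivity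
  have hgx : ∇ u x ≠ 0 := norm_pos_iff.1 hN0
  obtain ⟨-, lam, hlam, hcone, hsub⟩ := hu.subsolution x hx0
  obtain ⟨-, hmu⟩ := pHessian_radialFun (p := p) hm hG hGpos hΦ hne ⟨0, by omega⟩ rfl rfl
  rw [← hv, ← hN] at hmu
  set r := ‖x - y‖ with hrdef
  set N := ‖∇ u x‖ with hNdef
  have hp1 : 0 < p - 1 := by linarith
  have hcomp := elemSymm_le_of_isLocalMax hp (hu.contDiffAt_two hx0)
    (contDiffAt_radialFun hΦ2 hne) hmax hgx hlam hmu hcone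
  have hSpos := hcone k (Finset.mem_Icc.2 ⟨hk, le_rfl⟩)
  have hlow := IsAdmissibleSubsolutionAt.pow_le hk hx0 hgx hSpos.le hsub (hf_pos _)
  -- Products without the radial eigenvalue produce the `+ 1` in `hineq`. The common factor `N^{βk}`
  -- cancels, whatever the sign of `β`.
  have hup := elemSymm_le_two_pow_mul (k := k)
    (a := (p - 1) * N ^ (p - 1) * (G' (v x) * r ^ m + m / r)) (b := N ^ (p - 1) / r)
    (⟨0, by omega⟩ : Fin n) (by positivity) (by positivity)
  have hWk := rpow_sub_one_pow_eq (m := m) hs hr hq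
  rw [← hN] at hWk
  rw [radial_eigenvalue_mul_pow_eq hk hs hr hq hN rfl, div_pow, hWk, hmq, Real.rpow_natCast] at hup
  have hWr : (N ^ β) ^ k * (G (v x) ^ q * r ^ k) / r ^ k = (N ^ β) ^ k * G (v x) ^ q := by
    rw [← mul_assoc, mul_div_cancel_right₀ _ (by positivity)]
  rw [hWr, mul_div_cancel_right₀ _ (by positivity)] at hup
  have hvx : Φ (r ^ (1 + m) / (1 + m)) = v x := rfl
  have hfin := hineq r hr hx
  rw [hvx] at hfin
  have huv : v x ≤ u x := by
    linarith
  have hfv := hf_pos (v x)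
  have hfu := hf_mono huv
  -- As `α ≤ 0`, the weight on the ball is bounded below by its value at radius `R`.
  have hRα : R ^ α ≤ ‖x‖ ^ α := Real.rpow_le_rpow_of_nonpos hx0' hxR hα
  have hR0 : 0 < R := hx0'.trans_le hxR
  have h1 : (R ^ α * f (v x)) ^ k * (N ^ β) ^ k ≤ (‖x‖ ^ α * N ^ β * f (u x)) ^ k := by
    rw [← mul_pow]
    refine pow_le_pow_left₀ (by positivity) ?_ k
    calc R ^ α * f (v x) * N ^ β ≤ ‖x‖ ^ α * f (u x) * N ^ β := by gcongr
      _ = _ := by ring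
  have hNk : 0 < (N ^ β) ^ k := by positivity
  have h2 := mul_lt_mul_of_pos_right hfin hNk
  have h3 : 2 ^ n * ((p - 1) * (G' (v x) * r ^ (m + 1) + m) + 1) * G (v x) ^ q * (N ^ β) ^ k =
      2 ^ n * ((N ^ β) ^ k * G (v x) ^ q * ((p - 1) * (G' (v x) * r ^ (m + 1) + m)) +
        (N ^ β) ^ k * G (v x) ^ q) := by ring
  rw [h3] at h2
  linarith

end MaximumPrinciple

/-! ### Profiles reaching any height in bounded time. -/

section Barrier

open Filter Set

variable {F : ℝ → ℝ} {q v₀ : ℝ}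

/-- Integrability of the decreasing integrand gives `t^{q+1} ≤ ∫_0^t F ≤ t F(t)` for large `t`; the
constant absorbs the bounded range. -/
theorem exists_rpow_le_mul_of_not_kellerOsserman (hF : Continuous F) (hmono : Monotone F)
    (hpos : ∀ t, 0 < F t) (hq : 0 < q) {c : ℝ} (hc : 0 < c)
    (hint : IntegrableOn (fun t => (∫ s in (0 : ℝ)..t, F s) ^ (-(1 / (q + 1)))) (Ioi c)) :
    ∃ B, 0 < B ∧ ∀ s, v₀ ≤ s → (s - v₀ + 1) ^ q ≤ B * F s := by
  have hq1 : 0 < 1 / (q + 1) := by positivity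
  have hprim_pos : ∀ t, 0 < t → 0 < ∫ s in (0 : ℝ)..t, F s := fun t ht =>
    intervalIntegral.intervalIntegral_pos_of_pos (hF.intervalIntegrable 0 t) hpos ht
  have hanti : AntitoneOn (fun t => (∫ s in (0 : ℝ)..t, F s) ^ (-(1 / (q + 1)))) (Ioi c) := by
    intro s hs t ht hst
    refine Real.rpow_le_rpow_of_nonpos (hprim_pos s (hc.trans hs)) ?_ (by linarith)
    have h1 := intervalIntegral.integral_add_adjacent_intervals (μ := volume)
      (hF.intervalIntegrable 0 s) (hF.intervalIntegrable s t)
    have h2 := intervalIntegral.integral_nonneg (μ := volume) hst (fun r _ => (hpos r).le)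
    linarith
  obtain ⟨t₁, ht₁⟩ := eventually_atTop.1
    ((eventually_mul_le_one_of_antitoneOn hanti hint).and (eventually_gt_atTop 0))
  have hgrow : ∀ t, t₁ ≤ t → t ^ q ≤ F t := by
    intro t ht
    obtain ⟨h1, ht0⟩ := ht₁ t ht
    have hP := hprim_pos t ht0
    have h2 : t ≤ (∫ s in (0 : ℝ)..t, F s) ^ (1 / (q + 1)) := by
      rwa [Real.rpow_neg hP.le, ← div_eq_mul_inv, div_le_one (by positivity)] at h1
    have h3 : t ^ (q + 1) ≤ ∫ s in (0 : ℝ)..t, F s := by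
      have := Real.rpow_le_rpow ht0.le h2 (by positivity : 0 ≤ q + 1)
      rwa [← Real.rpow_mul hP.le, one_div_mul_cancel (by positivity), Real.rpow_one] at this
    have h4 := intervalIntegral.integral_mono_on (μ := volume) ht0.le
      (hF.intervalIntegrable 0 t) (g := fun _ => F t) intervalIntegrable_const
      (fun s hs => hmono hs.2)
    rw [intervalIntegral.integral_const, smul_eq_mul, sub_zero] at h4
    rw [Real.rpow_add_one ht0.ne', mul_comm] at h3
    exact le_of_mul_le_mul_left (h3.trans h4) ht0
  -- Beyond `t₂` one has `s - v₀ + 1 ≤ 2s`; below it the left side is bounded and `F ≥ F v₀`.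
  set t₂ := max (max t₁ (1 - v₀)) v₀ with ht₂
  have hFv := hpos v₀
  have ht₂v : v₀ ≤ t₂ := le_max_right _ _
  refine ⟨2 ^ q + (t₂ - v₀ + 1) ^ q / F v₀, ?_, fun s hs => ?_⟩
  · have : 0 ≤ t₂ - v₀ + 1 := by linarith
    positivity
  have hFs := hpos s
  have hX : 0 ≤ t₂ - v₀ + 1 := by linarith
  rw [add_mul]
  rcases le_total s t₂ with h | h
  · have h1 : (s - v₀ + 1) ^ q ≤ (t₂ - v₀ + 1) ^ q :=
      Real.rpow_le_rpow (by linarith) (by linarith) hq.le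
    have h2 : (t₂ - v₀ + 1) ^ q ≤ (t₂ - v₀ + 1) ^ q / F v₀ * F s := by
      calc (t₂ - v₀ + 1) ^ q = (t₂ - v₀ + 1) ^ q / F v₀ * F v₀ := by field_simp
        _ ≤ _ := mul_le_mul_of_nonneg_left (hmono hs) (by positivity)
    have h3 : 0 < (2 : ℝ) ^ q * F s := by positivity
    linarith
  · have hs1 : t₁ ≤ s := ((le_max_left _ _).trans (le_max_left _ _)).trans h
    have hs2 : 1 - v₀ ≤ s := ((le_max_right _ _).trans (le_max_left _ _)).trans h
    have hs0 := (ht₁ s hs1).2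
    have h1 : (s - v₀ + 1) ^ q ≤ (2 * s) ^ q :=
      Real.rpow_le_rpow (by linarith) (by linarith) hq.le
    rw [Real.mul_rpow (by norm_num) hs0.le] at h1
    have h2 : (2 : ℝ) ^ q * s ^ q ≤ 2 ^ q * F s :=
      mul_le_mul_of_nonneg_left (hgrow s hs1) (by positivity)
    have h3 : 0 ≤ (t₂ - v₀ + 1) ^ q / F v₀ * F s := by positivity
    linarith

/-- If the Keller–Osserman condition fails, there are profiles `Φ' = G(Φ)` which start at `v₀` and
reach arbitrarily large values within a bounded time. -/
theorem exists_barrier_of_not_kellerOsserman (hF : Continuous F) (hmono : Monotone F)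
    (hpos : ∀ t, 0 < F t) (hq : 0 < q) (hv₀ : v₀ ≤ 0) (hKO : ¬ KellerOsserman F q) :
    ∃ B T : ℝ, 0 < B ∧ 0 < T ∧ ∀ D : ℝ, 0 < D → ∀ M₀ : ℝ, ∃ Φ G G' : ℝ → ℝ,
      (∀ s, HasDerivAt G (G' s) s) ∧ Continuous G' ∧ (∀ s, 0 < G s) ∧ (∀ s, 0 ≤ G' s) ∧
      (∀ t, HasDerivAt Φ (G (Φ t)) t) ∧ StrictMono Φ ∧ Φ 0 = v₀ ∧ M₀ ≤ Φ (T / D) ∧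
      ∀ s, v₀ ≤ s → G s ^ q ≤ D ^ q * B * F s ∧ G s ^ q * G' s ≤ D ^ (q + 1) / (q + 1) * F s := by
  unfold KellerOsserman at hKO
  push Not at hKO
  obtain ⟨c, hc, hfin⟩ := hKO
  have hq1 : 0 < 1 / (q + 1) := by positivity
  have hprim_pos : ∀ t, 0 < t → 0 < ∫ s in (0 : ℝ)..t, F s := fun t ht =>
    intervalIntegral.intervalIntegral_pos_of_pos (hF.intervalIntegrable 0 t) hpos ht
  set h : ℝ → ℝ := fun t => (∫ s in (0 : ℝ)..t, F s) ^ (-(1 / (q + 1))) with hh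
  have hprim_cont : Continuous fun t => ∫ s in (0 : ℝ)..t, F s :=
    continuous_iff_continuousAt.2 fun t =>
      ((hF.integral_hasStrictDerivAt 0 t).hasDerivAt).continuousAt
  have hh_cont : ContinuousOn h (Ici c) :=
    hprim_cont.continuousOn.rpow_const fun t ht => Or.inl (hprim_pos t (hc.trans_le ht)).ne'
  have hh0 : ∀ t, c ≤ t → 0 ≤ h t := fun t ht =>
    Real.rpow_nonneg (hprim_pos t (hc.trans_le ht)).le _
  have hint : IntegrableOn h (Ioi c) := by
    refine ⟨(hh_cont.mono Ioi_subset_Ici_self).aestronglyMeasurable measurableSet_Ioi, ?_⟩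
    rw [hasFiniteIntegral_iff_ofReal ((ae_restrict_iff' measurableSet_Ioi).2
      (Eventually.of_forall fun t ht => hh0 t (le_of_lt ht)))]
    exact lt_top_iff_ne_top.2 hfin
  obtain ⟨B₁, hB₁, hgrow⟩ := exists_rpow_le_mul_of_not_kellerOsserman (v₀ := v₀) hF hmono hpos hq
    hc hint
  set c₁ : ℝ := 1 / F v₀ + 1 with hc₁
  have hFv := hpos v₀
  have hc₁0 : 0 < c₁ := by positivity
  set I : ℝ := ∫ t in Ioi c, h t with hI
  have hI0 : 0 ≤ I := setIntegral_nonneg measurableSet_Ioi fun t ht => hh0 t (le_of_lt ht)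
  refine ⟨c₁ ^ (q / (q + 1)) * B₁ ^ (1 / (q + 1)), c - v₀ + I, by positivity, by linarith,
    fun D hD M₀ => ?_⟩
  set M := max M₀ c with hM
  have hcM : c ≤ M := le_max_right _ _
  -- The upper cutoff makes `G` constant beyond `M + 1`, so the profile is global; on `[v₀, M]`
  -- nothing is changed.
  set g : ℝ → ℝ := fun s => F s * (max 0 (min 1 (s - v₀ + 1)) * max 0 (min 1 (M + 1 - s))) with hg
  have hg_cont : Continuous g := by fun_prop
  have hcut : ∀ z : ℝ, 0 ≤ max 0 (min 1 z) ∧ max 0 (min 1 z) ≤ 1 := fun z =>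
    ⟨le_max_left _ _, max_le zero_le_one (min_le_left _ _)⟩
  have hg0 : ∀ s, 0 ≤ g s := fun s =>
    mul_nonneg (hpos s).le (mul_nonneg (hcut _).1 (hcut _).1)
  have hgle : ∀ s, g s ≤ F s := fun s => mul_le_of_le_one_right (hpos s).le
    (mul_le_one₀ (hcut _).2 (hcut _).1 (hcut _).2)
  have hga : ∀ s ≤ v₀ - 1, g s = 0 := by
    intro s hs
    have : max 0 (min 1 (s - v₀ + 1)) = 0 := max_eq_left ((min_le_right _ _).trans (by linarith))
    simp [hg, this]
  have hgb : ∀ s, M + 1 ≤ s → g s = 0 := by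
    intro s hs
    have : max 0 (min 1 (M + 1 - s)) = 0 := max_eq_left ((min_le_right _ _).trans (by linarith))
    simp [hg, this]
  have hg1 : ∀ s, v₀ ≤ s → s ≤ M → g s = F s := by
    intro s h1 h2
    have e1 : max 0 (min 1 (s - v₀ + 1)) = 1 := by rw [min_eq_left (by linarith)]; simp
    have e2 : max 0 (min 1 (M + 1 - s)) = 1 := by rw [min_eq_left (by linarith)]; simp
    simp [hg, e1, e2]
  have hgi : ∀ x y, IntervalIntegrable g volume x y := fun x y => hg_cont.intervalIntegrable x y
  set G := speed q 1 D g (v₀ - 1) with hGdef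
  set G' := speedDeriv q 1 D g (v₀ - 1) with hG'def
  have hGd : ∀ s, HasDerivAt G (G' s) s := hasDerivAt_speed hg_cont hg0 hga one_pos
  have hG'c : Continuous G' := continuous_speedDeriv hg_cont hg0 hga one_pos
  have hGc : Continuous G := continuous_speed hg_cont hg0 hga one_pos
  have hGpos : ∀ s, 0 < G s := speed_pos hg0 hga one_pos hD
  have hG'0 : ∀ s, 0 ≤ G' s := speedDeriv_nonneg hg0 hga one_pos hD hq
  have hGmono : Monotone G := monotone_of_deriv_nonneg (fun s => (hGd s).differentiableAt)
    fun s => by rw [(hGd s).deriv]; exact hG'0 s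
  have hGtop : ∀ s, G s ≤ G (M + 1) := by
    intro s
    rcases le_total s (M + 1) with hs | hs
    · exact hGmono hs
    · refine le_of_eq ?_
      have h1 := intervalIntegral.integral_add_adjacent_intervals (hgi (v₀ - 1) (M + 1))
        (hgi (M + 1) s)
      have h2 : ∫ r in (M + 1)..s, g r = 0 := by
        rw [intervalIntegral.integral_congr (g := fun _ => (0 : ℝ))]
        · simp
        · intro r hr
          rw [uIcc_of_le hs] at hr
          exact hgb r hr.1
      rw [hGdef, speed, speed, ← h1, h2, add_zero]
  obtain ⟨Φ, hΦ, hΦmono, hΦτ⟩ := exists_hasDerivAt_comp_self hGc hGpos v₀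
    (tendsto_integral_inv_atBot_of_le hGc hGpos (M := G (M + 1)) fun s _ => hGtop s)
    (tendsto_integral_inv_atTop_of_le hGc hGpos (M := G (M + 1)) fun s _ => hGtop s)
  have hΦ0 : Φ 0 = v₀ := by
    have := hΦτ v₀
    rwa [intervalIntegral.integral_same] at this
  refine ⟨Φ, G, G', hGd, hG'c, hGpos, hG'0, hΦ, hΦmono, hΦ0, ?_, fun s hs => ⟨?_, ?_⟩⟩
  -- The climb from `v₀` to `c` has speed at least `D`, and takes time at most `(c - v₀)/D`. From
  -- `c` to `M` the speed is at least `D/h`, and the time at most `I/D`. Neither bound depends on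
  -- `M`.
  · refine (le_max_left M₀ c).trans ?_
    rw [← hM, ← hΦτ M]
    refine hΦmono.monotone ?_
    have hGinv : Continuous fun r => (G r)⁻¹ := hGc.inv₀ fun r => (hGpos r).ne'
    have hcv : v₀ ≤ c := by linarith
    rw [← intervalIntegral.integral_add_adjacent_intervals (hGinv.intervalIntegrable v₀ c)
      (hGinv.intervalIntegrable c M), add_div]
    refine add_le_add ?_ ?_
    · have h1 := intervalIntegral.integral_mono_on (μ := volume) hcv
        (hGinv.intervalIntegrable v₀ c) (g := fun _ => D⁻¹) intervalIntegrable_const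
        (fun s hs => inv_anti₀ hD (by
          have h2 := integral_nonneg_of_eq_zero_Iic hg0 hga s
          rw [hGdef, speed]
          exact le_mul_of_one_le_right hD.le (Real.one_le_rpow (by linarith) hq1.le)))
      rwa [intervalIntegral.integral_const, smul_eq_mul, ← div_eq_mul_inv] at h1
    · have hhi : IntervalIntegrable h volume c M :=
        (hh_cont.mono (by rw [uIcc_of_le hcM]; exact Icc_subset_Ici_self)).intervalIntegrable
      have h1 := intervalIntegral.integral_mono_on (μ := volume) hcM
        (hGinv.intervalIntegrable c M) (g := fun s => D⁻¹ * h s) (hhi.const_mul _)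
        (fun s hs => by
          have hs0 : 0 < s := hc.trans_le hs.1
          have hP := hprim_pos s hs0
          have h2 := intervalIntegral.integral_add_adjacent_intervals (hgi (v₀ - 1) 0) (hgi 0 s)
          have h3 := intervalIntegral.integral_nonneg (μ := volume) (by linarith : v₀ - 1 ≤ 0)
            (fun r _ => hg0 r)
          have h4 : ∫ r in (0 : ℝ)..s, g r = ∫ r in (0 : ℝ)..s, F r := by
            refine intervalIntegral.integral_congr fun r hr => ?_
            rw [uIcc_of_le hs0.le] at hr
            exact hg1 r (hv₀.trans hr.1) (hr.2.trans hs.2)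
          rw [hh, hGdef, speed]
          dsimp only
          rw [Real.rpow_neg hP.le, mul_inv]
          refine mul_le_mul_of_nonneg_left (inv_anti₀ (by positivity) ?_) (by positivity)
          exact Real.rpow_le_rpow hP.le (by linarith) hq1.le)
      refine h1.trans ?_
      rw [intervalIntegral.integral_const_mul, mul_comm, ← div_eq_mul_inv]
      refine div_le_div_of_nonneg_right ?_ hD.le
      rw [intervalIntegral.integral_of_le hcM]
      exact setIntegral_mono_set hint ((ae_restrict_iff' measurableSet_Ioi).2
        (Eventually.of_forall fun t ht => hh0 t (le_of_lt ht)))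
        (Eventually.of_forall Ioc_subset_Ioi_self)
  · have hFs := hpos s
    have hnn := integral_nonneg_of_eq_zero_Iic hg0 hga s
    rw [hGdef, speed_rpow hg0 hga one_pos hD, mul_assoc]
    refine mul_le_mul_of_nonneg_left ?_ (by positivity)
    -- The base of `G` is at most `c₁ X F(s)`, and `X^q ≤ B₁ F(s)`; so its power `q/(q+1)` is at
    -- most a constant times `F(s)`.
    have h1 := intervalIntegral.integral_mono_on (μ := volume) (by linarith : v₀ - 1 ≤ s)
      (hgi (v₀ - 1) s) (g := fun _ => F s) intervalIntegrable_const
      (fun r hr => (hgle r).trans (hmono hr.2))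
    rw [intervalIntegral.integral_const, smul_eq_mul] at h1
    set X : ℝ := s - v₀ + 1 with hX
    have hX1 : 1 ≤ X := by linarith
    have hX0 : 0 < X := by linarith
    have h2 : 1 + ∫ r in (v₀ - 1)..s, g r ≤ c₁ * (X * F s) := by
      have h3 : 1 ≤ 1 / F v₀ * (X * F s) := by
        have : F v₀ ≤ X * F s := (hmono hs).trans (le_mul_of_one_le_left hFs.le hX1)
        rw [one_div, ← div_eq_inv_mul, le_div_iff₀ hFv]
        linarith
      have h4 : (s - (v₀ - 1)) * F s = X * F s := by rw [hX]; ring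
      rw [hc₁, add_mul]
      linarith
    have hsum : 1 / (q + 1) + q / (q + 1) = 1 := by field_simp; ring
    calc (1 + ∫ r in (v₀ - 1)..s, g r) ^ (q / (q + 1)) ≤ (c₁ * (X * F s)) ^ (q / (q + 1)) :=
          Real.rpow_le_rpow (by linarith) h2 (by positivity)
      _ = c₁ ^ (q / (q + 1)) * ((X ^ q) ^ (1 / (q + 1)) * F s ^ (q / (q + 1))) := by
          rw [Real.mul_rpow hc₁0.le (by positivity), Real.mul_rpow hX0.le hFs.le,
            ← Real.rpow_mul hX0.le, mul_one_div]
      _ ≤ c₁ ^ (q / (q + 1)) * ((B₁ * F s) ^ (1 / (q + 1)) * F s ^ (q / (q + 1))) := by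
          have := hgrow s hs
          gcongr
      _ = c₁ ^ (q / (q + 1)) * B₁ ^ (1 / (q + 1)) * F s := by
          rw [Real.mul_rpow hB₁.le hFs.le, mul_assoc (B₁ ^ (1 / (q + 1))), ← Real.rpow_add hFs,
            hsum, Real.rpow_one, mul_assoc]
  · rw [hGdef, hG'def, speed_rpow_mul_speedDeriv hg0 hga one_pos hD hq]
    exact mul_le_mul_of_nonneg_left (hgle s) (by positivity)

end Barrier

/-! ### Necessity of the integral condition. -/

section Necessity

open Filter
open scoped Gradient Topology

variable {n k : ℕ} {p α β : ℝ} {f : ℝ → ℝ} {u : EuclideanSpace ℝ (Fin n) → ℝ}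

/-- The Keller–Osserman condition is necessary for the existence of an entire subsolution. -/
theorem IsEntireSubsolution.kellerOsserman (hu : IsEntireSubsolution k p α β f u)
    (hk : 1 ≤ k) (hkn : k ≤ n) (hp : 1 < p) (hα : -1 < α) (hα0 : α ≤ 0) (hβ : β < p - 1)
    (hf_cont : Continuous f) (hf_mono : Monotone f) (hf_pos : ∀ t, 0 < f t) :
    KellerOsserman (fun s => f s ^ k) (k * (p - β - 1)) := by
  by_contra hKO
  have hk0 : (0 : ℝ) < k := by exact_mod_cast hk
  have hpβ : 0 < p - β - 1 := by linarith
  have hp1 : 0 < p - 1 := by linarith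
  set q : ℝ := k * (p - β - 1) with hq
  have hq0 : 0 < q := by positivity
  -- Near a centre away from the origin the weight is not singular, so this is the exponent for `α =
  -- 0`.
  set m : ℝ := 1 / (p - β - 1) with hmdef
  have hm : 0 < m := by positivity
  have hmq : m * q = k := by rw [hmdef, hq]; field_simp
  set v₀ : ℝ := min (u 0 - 1) 0 with hv₀
  obtain ⟨B, T, hB, hT, hbar⟩ := exists_barrier_of_not_kellerOsserman
    (F := fun s => f s ^ k) (v₀ := v₀) (hf_cont.pow k)
    (fun s t hst => pow_le_pow_left₀ (hf_pos s).le (hf_mono hst) k)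
    (fun t => pow_pos (hf_pos t) k) hq0 (min_le_right _ _ : v₀ ≤ 0) hKO
  set K : ℝ := 2 ^ n * ((p - 1) * (T * (1 + m) / (q + 1)) + ((p - 1) * m + 1) * B) with hK
  have hK0 : 0 < K := by positivity
  -- The left side decays like `ρ^{-(q+k)}` and the right side is a multiple of `ρ^{αk}`; as `q +
  -- k(α+1) > 0`, a large `ρ` works.
  obtain ⟨ρ, hρ, hρK⟩ : ∃ ρ : ℝ, 0 < ρ ∧
      K * (T * (1 + m) / ρ ^ (1 + m)) ^ q < ((4 * ρ) ^ α) ^ k := by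
    have hexp : 0 < k * (α + 1) + q := by
      have : 0 < k * (α + 1) := mul_pos hk0 (by linarith)
      linarith
    have ht := (tendsto_rpow_atTop hexp).eventually
      (eventually_gt_atTop (K * (T * (1 + m)) ^ q / ((4 : ℝ) ^ α) ^ k))
    obtain ⟨ρ, h1, h2⟩ := (ht.and (eventually_gt_atTop 0)).exists
    refine ⟨ρ, h2, ?_⟩
    rw [div_lt_iff₀ (by positivity)] at h1
    rw [Real.div_rpow (by positivity) (by positivity), ← mul_div_assoc, div_lt_iff₀ (by positivity),
      Real.mul_rpow (by norm_num) h2.le, mul_pow]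
    refine h1.trans_eq ?_
    rw [← Real.rpow_natCast (ρ ^ α), ← Real.rpow_mul h2.le, ← Real.rpow_mul h2.le,
      mul_assoc, ← Real.rpow_add h2, mul_comm]
    congr 2
    rw [add_mul 1 m, hmq]
    ring
  -- The speed for which the barrier reaches the height `M₀` exactly by `r = ρ`.
  set D : ℝ := T * (1 + m) / ρ ^ (1 + m) with hD
  have hD0 : 0 < D := by positivity
  have hTD : T / D = ρ ^ (1 + m) / (1 + m) := by rw [hD]; field_simp
  have hest : ∀ y : EuclideanSpace ℝ (Fin n), 2 * ρ < ‖y‖ → ‖y‖ < 3 * ρ → ∇ u y ≠ 0 →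
      u y ≤ v₀ := by
    intro y hy1 hy2 hgy
    obtain ⟨M₀, hM₀⟩ := ((isCompact_closedBall y ρ).image
      hu.contDiff_one.continuous).isBounded.bddAbove
    obtain ⟨Φ, G, G', hG, hG'c, hGpos, hG'0, hΦ, hΦmono, hΦ0, hΦM, hGb⟩ := hbar D hD0 M₀
    rw [hTD] at hΦM
    refine hu.le_of_barrier hk hkn hp hα0 hm hq hmq hf_mono hf_pos hG hG'c hGpos hG'0 hΦ hρ hΦ0
      (R := 4 * ρ) (by linarith) (by linarith) hgy (fun x hx => ?_) (fun r hr hrρ => ?_)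
    · refine (hM₀ (Set.mem_image_of_mem u ?_)).trans hΦM
      rw [Metric.mem_closedBall, dist_eq_norm, hx]
    · set s := Φ (r ^ (1 + m) / (1 + m)) with hs
      have hsv : v₀ ≤ s := by
        rw [← hΦ0]
        exact hΦmono.monotone (by positivity)
      obtain ⟨hb1, hb2⟩ := hGb s hsv
      have hfs := hf_pos s
      have hrm : r ^ (m + 1) ≤ ρ ^ (1 + m) := by
        rw [add_comm m 1]
        exact Real.rpow_le_rpow hr.le hrρ.le (by positivity)
      have hρm : 0 < ρ ^ (1 + m) := by positivity
      have hGG : 0 ≤ G s ^ q * G' s := mul_nonneg (Real.rpow_nonneg (hGpos s).le _) (hG'0 s)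
      have h1 : G s ^ q * G' s * r ^ (m + 1) ≤ D ^ q * (T * (1 + m) / (q + 1)) * f s ^ k := by
        calc G s ^ q * G' s * r ^ (m + 1) ≤ D ^ (q + 1) / (q + 1) * f s ^ k * ρ ^ (1 + m) :=
              mul_le_mul hb2 hrm (by positivity) (by positivity)
          _ = _ := by
              rw [Real.rpow_add_one hD0.ne']
              have : D * ρ ^ (1 + m) = T * (1 + m) := by rw [hD]; field_simp
              linear_combination (D ^ q / (q + 1) * f s ^ k) * this
      calc 2 ^ n * ((p - 1) * (G' s * r ^ (m + 1) + m) + 1) * G s ^ q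
          = 2 ^ n * ((p - 1) * (G s ^ q * G' s * r ^ (m + 1)) + ((p - 1) * m + 1) * G s ^ q) := by
            ring
        _ ≤ 2 ^ n * ((p - 1) * (D ^ q * (T * (1 + m) / (q + 1)) * f s ^ k) +
              ((p - 1) * m + 1) * (D ^ q * B * f s ^ k)) := by gcongr
        _ = K * D ^ q * f s ^ k := by rw [hK]; ring
        _ < ((4 * ρ) ^ α) ^ k * f s ^ k := mul_lt_mul_of_pos_right hρK (by positivity)
        _ = _ := by rw [mul_pow]
  -- Continuity and the density of points with `Du ≠ 0` extend the estimate to the whole sphere.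
  have hsphere : ∀ x : EuclideanSpace ℝ (Fin n), ‖x‖ = 5 / 2 * ρ → u x ≤ v₀ := by
    intro x hx
    have hx0 : x ≠ 0 := by
      rw [← norm_pos_iff, hx]
      positivity
    by_contra hlt
    push Not at hlt
    have h1 : ∀ᶠ z in 𝓝 x, v₀ < u z :=
      hu.contDiff_one.continuous.continuousAt.eventually (lt_mem_nhds hlt)
    have h2 : ∀ᶠ z in 𝓝 x, 2 * ρ < ‖z‖ :=
      continuous_norm.continuousAt.eventually
        (lt_mem_nhds (show 2 * ρ < ‖x‖ by rw [hx]; linarith))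
    have h3 : ∀ᶠ z in 𝓝 x, ‖z‖ < 3 * ρ :=
      continuous_norm.continuousAt.eventually
        (gt_mem_nhds (show ‖x‖ < 3 * ρ by rw [hx]; linarith))
    obtain ⟨z, hz, hz1, hz2, hz3⟩ :=
      ((hu.frequently_gradient_ne_zero hk hx0).and_eventually (h1.and (h2.and h3))).exists
    exact absurd (hest z hz2 hz3 hz) (not_le.2 hz1)
  have h0 := hu.le_of_forall_norm_eq hk hkn hp (by positivity) hsphere
  have := min_le_left (u 0 - 1) 0
  linarith

end Necessity



/-! ### The main theorem. -/

theorem theorem4p2 (n k : ℕ) (hk : 1 ≤ k) (hkn : k ≤ n) (p α β : ℝ) (f : ℝ → ℝ)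
    (hf_cont : Continuous f) (hf_mono : Monotone f) (hf_pos : ∀ t, 0 < f t)
    (hα : -1 < α) (hα' : α < 1 / (k : ℝ) - 1) (hβ : β < p - 1) (hp : 1 < p) :
    (∀ ε ∈ Set.Ioo (0 : ℝ) (k * (α + 1)), ∀ κ : ℝ, κ = (1 - ε) / (k * (α + 1) - ε) →
      KellerOsserman (fun s => f s ^ (κ * k)) (κ * k * (p - β - 1)) →
      ∃ u : EuclideanSpace ℝ (Fin n) → ℝ, IsEntireSubsolution k p α β f u ∧
        (p ≤ α + β + 2 → ContDiff ℝ 2 u) ∧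
        (α + β + 2 < p → 0 ≤ (p - 1) * α + β →
          ∀ δ ∈ Set.Ioo (1 : ℝ) ((p - β - 1) / (p - α - β - 2)), MemW2Loc δ u)) ∧
    ((∃ u : EuclideanSpace ℝ (Fin n) → ℝ, IsEntireSubsolution k p α β f u ∧
        ((p ≤ α + β + 2 ∧ ContDiff ℝ 2 u) ∨
          (α + β + 2 < p ∧ 0 ≤ (p - 1) * α + β ∧
            ∃ δ ∈ Set.Ioo (1 : ℝ) ((p - β - 1) / (p - α - β - 2)), MemW2Loc δ u))) →
      KellerOsserman (fun s => f s ^ k) (k * (p - β - 1))) := by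
  have hk1 : (1 : ℝ) ≤ k := by exact_mod_cast hk
  have hk0 : (0 : ℝ) < k := by linarith
  have hα0 : α ≤ 0 := by
    have : 1 / (k : ℝ) ≤ 1 := (div_le_one hk0).2 hk1
    linarith
  have hpβ : 0 < p - β - 1 := by linarith
  refine ⟨fun ε hε κ hκ hKO => ?_, fun ⟨u, hu, _⟩ =>
    hu.kellerOsserman hk hkn hp hα hα0 hβ hf_cont hf_mono hf_pos⟩
  have hkα : k * (α + 1) < 1 := by
    have h := mul_lt_mul_of_pos_left (show α + 1 < 1 / (k : ℝ) by linarith) hk0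
    rwa [mul_one_div_cancel hk0.ne'] at h
  -- The bound `α < 1/k - 1` means `k(α+1) < 1`, so the numerator of `κ` exceeds its denominator.
  have hκ1 : 1 ≤ κ := by
    rw [hκ, one_le_div (by linarith [hε.2])]
    linarith
  set m : ℝ := (α + 1) / (p - β - 1) with hm
  have hm0 : 0 < m := div_pos (by linarith) hpβ
  obtain ⟨Φ, G, G', hG, hG'c, hΦ, hsub⟩ :=
    exists_profile_of_kellerOsserman hk hkn hp hα hβ hf_cont hf_mono hf_pos hκ1 hKO hm
  refine ⟨radialFun Φ m 0, hsub, fun h => ?_, fun h _ δ hδ => ?_⟩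
  · exact contDiff_two_radialFun ((one_le_div hpβ).2 (by linarith)) hG hG'c hΦ 0
  -- With this identity the upper bound on `δ` becomes `(1-m)δ < 1`.
  · have hm1 : 1 - m = (p - α - β - 2) / (p - β - 1) := by
      rw [hm]
      field_simp
      ring
    have hpα : 0 < p - α - β - 2 := by linarith
    refine memW2Loc_radialFun (hk.trans hkn) hm0 ((div_lt_one hpβ).2 (by linarith)) hG hG'c hΦ
      hδ.1.le ?_
    rw [hm1, div_mul_eq_mul_div, div_lt_one hpβ, mul_comm]
    exact (lt_div_iff₀ hpα).1 hδ.2
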